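/- Let $N\in\mathbb N$, $1<p<N$, $C_0>0$ and $C_1$ be real numbers. For $r\ge 0$ let $K_r=\{x\in\mathbb R^N: |x_i|<r/2,\ i=1,\dots,N\}$ be the open cube of side $r$ centred at the origin, and let $\operatorname{osc}(u;K)=\operatorname{ess\,sup}_K u-\operatorname{ess\,inf}_K u$, understood as $0$ when $|K|=0$. There exist constants $C,\alpha>0$, depending only on $N,p,C_0,C_1$, with the following property. Let $R>0$ and let $A:\mathbb R^N\times\mathbb R\times\mathbb R^N\to\mathbb R^N$ satisfy, for a.e. $x\in K_{2R}$ and all $s\in\mathbb R$, $z\in\mathbb R^N$, $$A(x,s,z)\cdot z\ge C_0|z|^p,\qquad |A(x,s,z)|\le C_1|z|^{p-1}.$$ Let $u\in W^{1,p}_{\rm loc}(K_{2R})\cap L^\infty_{\rm loc}(K_{2R})$ be a weak solution of $\operatorname{div}A(x,u,Du)=0$ in $K_{2R}$, that is, $x\mapsto A(x,u(x),Du(x))$ is measurable on $K_{2R}$ (which is automatic if $A$ is Borel measurable or a Carathéodory function) and $$\int_{K_{2R}}A(x,u,Du)\cdot D\varphi\,dx=0\qquad\text{for all }\varphi\in C_c^\infty(K_{2R}).$$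 Then $$\operatorname{osc}(u;K_\rho)\le C\,\operatorname{osc}(u;K_R)\,(\rho/R)^{\alpha}\qquad\text{for all }0\le\rho\le R/2 .$$ -/

import Mathlib

open MeasureTheory
open scoped ContDiff

/-- `ℝᴺ` with its Euclidean structure. -/
abbrev RN (N : ℕ) : Type := EuclideanSpace ℝ (Fin N)

/-- The open cube `K_r` of side `r` (not half-side) centred at the origin, with sides parallel to
the axes. -/
def cube (N : ℕ) (r : ℝ) : Set (RN N) := {x | ∀ i, |x i| < r / 2}

/-- `φ ∈ C_c^∞(Ω)`. -/
structure IsTestFunction {N : ℕ} (Ω : Set (RN N)) (φ : RN N → ℝ) : Prop where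
  smooth : ContDiff ℝ ∞ φ
  hasCompactSupport : HasCompactSupport φ
  tsupport_subset : tsupport φ ⊆ Ω

/-- `G` is the weak (distributional) gradient of `u` in `Ω`: both are locally integrable and
`∫_Ω u ∂ᵢφ = - ∫_Ω Gᵢ φ` for all `φ ∈ C_c^∞(Ω)` and all `i`. -/
structure HasWeakGradient {N : ℕ} (Ω : Set (RN N)) (u : RN N → ℝ) (G : RN N → RN N) :
    Prop where
  locallyIntegrableOn : LocallyIntegrableOn u Ω volume
  locallyIntegrableOn_gradient : LocallyIntegrableOn G Ω volume
  integral_eq : ∀ φ : RN N → ℝ, IsTestFunction Ω φ → ∀ i : Fin N,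
    ∫ x in Ω, u x * fderiv ℝ φ x (EuclideanSpace.single i 1) = - ∫ x in Ω, G x i * φ x

/-- `f ∈ L^p_loc(Ω)`: `f` is in `L^p` of every compact subset of `Ω`. -/
def MemLpLoc {N : ℕ} {F : Type*} [NormedAddCommGroup F] (p : ℝ) (Ω : Set (RN N))
    (f : RN N → F) : Prop :=
  ∀ K : Set (RN N), IsCompact K → K ⊆ Ω → MemLp f (ENNReal.ofReal p) (volume.restrict K)

/-- `u ∈ L^∞_loc(Ω)` (apart from measurability): `u` is essentially bounded on every compact
subset of `Ω`. -/
def EssLocallyBounded {N : ℕ} (Ω : Set (RN N)) (u : RN N → ℝ) : Prop :=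
  ∀ K : Set (RN N), IsCompact K → K ⊆ Ω → ∃ M : ℝ, ∀ᵐ x ∂volume.restrict K, |u x| ≤ M

/-- The `p`-growth conditions `A(x,s,z)·z ≥ C₀|z|^p`, `|A(x,s,z)| ≤ C₁|z|^{p-1}`, for almost every
`x ∈ Ω` and all `s ∈ ℝ`, `z ∈ ℝᴺ`. -/
structure PGrowth {N : ℕ} (p C₀ C₁ : ℝ) (Ω : Set (RN N)) (A : RN N → ℝ → RN N → RN N) :
    Prop where
  coercive : ∀ᵐ x ∂volume.restrict Ω, ∀ (s : ℝ) (z : RN N), C₀ * ‖z‖ ^ p ≤ inner ℝ (A x s z) z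
  bounded : ∀ᵐ x ∂volume.restrict Ω, ∀ (s : ℝ) (z : RN N), ‖A x s z‖ ≤ C₁ * ‖z‖ ^ (p - 1)

/-- `u` is a locally bounded weak solution of `div A(x,u,Du) = 0` in `Ω`: `u ∈ W^{1,p}_loc(Ω)` is
locally essentially bounded, and, `G` being its weak gradient, the field `x ↦ A(x,u(x),G(x))` is
measurable and `∫_Ω A(x,u,G)·Dφ dx = 0` for all `φ ∈ C_c^∞(Ω)`.

Measurability is asked of the composed field only. It is automatic when `A` is Borel measurable or
a Carathéodory function. -/
def IsWeakSolution {N : ℕ} (p : ℝ) (A : RN N → ℝ → RN N → RN N) (Ω : Set (RN N))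
    (u : RN N → ℝ) : Prop :=
  MemLpLoc p Ω u ∧ EssLocallyBounded Ω u ∧
    ∃ G : RN N → RN N, HasWeakGradient Ω u G ∧ MemLpLoc p Ω G ∧
      AEStronglyMeasurable (fun x => A x (u x) (G x)) (volume.restrict Ω) ∧
      ∀ φ : RN N → ℝ, IsTestFunction Ω φ → ∫ x in Ω, fderiv ℝ φ x (A x (u x) (G x)) = 0

/-- The oscillation `osc(u; K) = ess sup_K u - ess inf_K u` with respect to Lebesgue measure, for
`u` essentially bounded on `K`. On a null set its value is `0`. -/
noncomputable def osc {N : ℕ} (u : RN N → ℝ) (K : Set (RN N)) : ℝ :=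
  essSup u (volume.restrict K) - essInf u (volume.restrict K)

/-! ### Convergence of mollifications in `L^p` -/

section Mollification

open Filter Topology ContinuousLinearMap
open scoped ENNReal Convolution

variable {N : ℕ} {F : Type*} [NormedAddCommGroup F]

/-! The proof is De Giorgi's method. Since the structure conditions are the same at every height and
scale, it is enough that passing from a ball of radius `r` to the concentric ball of radius `r / 4`
multiplies the oscillation by a fixed `θ < 1` (`exists_osc_reduction`). Iterating this gives
geometric decay (`exists_holder_decay`), and the exponent is determined by `4 ^ (-α) = θ`. Cubes are
compared with balls only at the end.

The equation enters solely through the Caccioppoli inequality (`exists_caccioppoli_const`): if `u ≤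
k + H` on a ball, testing with a cutoff times a smooth version of `(u - k)₊` bounds the `L^p` norm
of the gradient on `{u > k}`, in a smaller ball, by `H` and the measure of `{u > k}`. Hölder's
inequality turns this into an `L¹` bound on any subset of `{u > k}`
(`exists_lintegral_gradient_le`), which is used twice.

With the `L¹` Sobolev inequality, of exponent `q = N / (N - 1)`, it gives a superlinear recursion
for the measures of superlevel sets. Hence, if `{u > k}` fills a small enough fraction of a ball, `u
≤ k + H / 2` on the half ball (`exists_sup_const`). With a Poincaré inequality it gives De Giorgi's
isoperimetric inequality: passing from a small to a large value costs measure in between. Since the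
layers between the levels `M - δ / 2 ^ n` are disjoint, this forces `{u > M - δ / 2 ^ n}` to become
small after a number of steps fixed in advance (`exists_shrink_index`), provided `u` is below its
middle level on half of the ball. Either `u` or `-u` has that property, so one of the two bounds
improves.

A weak solution is only a Sobolev function, so the test functions and both functional inequalities
are reached through smooth approximants that are uniformly bounded, converge almost everywhere, and
have gradients converging in `L^p` (`ApproxBy`). -/

theorem tendsto_eLpNorm_translate_sub {p : ℝ≥0∞} (hp : 1 ≤ p) (hp' : p ≠ ⊤) {f : RN N → F}
    (hf : MemLp f p volume) :
    Tendsto (fun y : RN N => eLpNorm (fun x => f (x - y) - f x) p volume) (𝓝 0) (𝓝 0) := by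
  have : Fact (1 ≤ p) := ⟨hp⟩
  let g : C(RN N, C(RN N, RN N)) :=
    ContinuousMap.curry ⟨fun z : RN N × RN N => z.2 - z.1, by fun_prop⟩
  have hmp : ∀ y : RN N, MeasurePreserving (g y) volume volume := fun y =>
    measurePreserving_sub_right volume y
  have h := Filter.Tendsto.compMeasurePreservingLp (l := 𝓝 (0 : RN N))
    (f := fun _ => hf.toLp f) tendsto_const_nhds (g.continuous.tendsto 0) hmp (hmp 0) hp'
  simp only [Lp.toLp_compMeasurePreserving] at h
  rw [Lp.tendsto_Lp_iff_tendsto_eLpNorm'' _ (fun y => hf.comp_measurePreserving (hmp y)) _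
    (hf.comp_measurePreserving (hmp 0))] at h
  refine h.congr fun y => ?_
  congr 1
  ext x
  simp [g]

/-- The normalised bump is a probability density, so Jensen's inequality applies to the average of
`f (x - y) - f x` at each `x`; Tonelli then exchanges the integrals. -/
theorem lintegral_convolution_sub_rpow_le [NormedSpace ℝ F] [CompleteSpace F] {r : ℝ}
    (hr : 1 ≤ r) (φ : ContDiffBump (0 : RN N))
    {f : RN N → F} (hf : LocallyIntegrable f volume) :
    ∫⁻ x, ‖(φ.normed volume ⋆[lsmul ℝ ℝ, volume] f) x - f x‖ₑ ^ r ≤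
      ∫⁻ y, ‖φ.normed volume y‖ₑ * ∫⁻ x, ‖f (x - y) - f x‖ₑ ^ r := by
  have hfm := hf.aestronglyMeasurable
  set k : RN N → ℝ≥0∞ := fun y => ‖φ.normed volume y‖ₑ with hk
  have hkm : Measurable k := φ.continuous_normed.measurable.enorm
  have hk1 : ∫⁻ y, k y = 1 := by
    have h1 := φ.integral_normed (μ := (volume : Measure (RN N)))
    have h2 := ofReal_integral_norm_eq_lintegral_enorm (φ.integrable_normed (μ := (volume : Measure (RN N))))
    rw [hk, ← h2]
    simp only [Real.norm_eq_abs, abs_of_nonneg (φ.nonneg_normed _), h1, ENNReal.ofReal_one]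
  have : IsProbabilityMeasure (volume.withDensity k) :=
    ⟨by rw [withDensity_apply _ MeasurableSet.univ, setLIntegral_univ, hk1]⟩
  have hmap : ∀ x : RN N, MeasurePreserving (fun y => x - y) volume volume := fun x =>
    Measure.measurePreserving_sub_left volume x
  have hpt : ∀ x, ‖(φ.normed volume ⋆[lsmul ℝ ℝ, volume] f) x - f x‖ₑ ^ r ≤
      ∫⁻ y, k y * ‖f (x - y) - f x‖ₑ ^ r := by
    intro x
    have hex : Integrable (fun y => φ.normed volume y • f (x - y)) volume :=
      φ.hasCompactSupport_normed.convolutionExists_left (lsmul ℝ ℝ) φ.continuous_normed hf x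
    have hex2 : Integrable (fun y => φ.normed volume y • f x) volume :=
      φ.integrable_normed.smul_const _
    have e1 : (φ.normed volume ⋆[lsmul ℝ ℝ, volume] f) x - f x =
        ∫ y, φ.normed volume y • (f (x - y) - f x) := by
      simp only [smul_sub]
      rw [integral_sub hex hex2, integral_smul_const, φ.integral_normed, one_smul]
      rfl
    have hm : AEStronglyMeasurable (fun y => f (x - y) - f x) (volume.withDensity k) :=
      ((hfm.comp_measurePreserving (hmap x)).sub aestronglyMeasurable_const).mono_ac
        (withDensity_absolutelyContinuous _ _)
    -- Jensen, in the form of monotonicity of `L^r` norms on a probability space.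
    have hj := eLpNorm'_le_eLpNorm'_of_exponent_le one_pos hr (volume.withDensity k) hm
    simp only [eLpNorm', ENNReal.rpow_one, div_one] at hj
    have hm2 : AEMeasurable (fun y => ‖f (x - y) - f x‖ₑ) volume :=
      ((hfm.comp_measurePreserving (hmap x)).sub aestronglyMeasurable_const).enorm
    rw [lintegral_withDensity_eq_lintegral_mul₀ hkm.aemeasurable hm2,
      lintegral_withDensity_eq_lintegral_mul₀ hkm.aemeasurable (hm2.pow_const r)] at hj
    have h2 : ‖(φ.normed volume ⋆[lsmul ℝ ℝ, volume] f) x - f x‖ₑ ≤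
        ∫⁻ y, k y * ‖f (x - y) - f x‖ₑ := by
      rw [e1]
      refine (enorm_integral_le_lintegral_enorm _).trans (le_of_eq ?_)
      simp [enorm_smul, hk]
    calc _ ≤ ((∫⁻ y, k y * ‖f (x - y) - f x‖ₑ ^ r) ^ (1 / r)) ^ r := by
          gcongr
          exact h2.trans hj
      _ = _ := by
          rw [← ENNReal.rpow_mul, one_div, inv_mul_cancel₀ (by linarith), ENNReal.rpow_one]
  refine (lintegral_mono hpt).trans (le_of_eq ?_)
  rw [lintegral_lintegral_swap]
  · refine lintegral_congr fun y => ?_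
    rw [lintegral_const_mul'' _ ?_]
    exact (((hfm.comp_measurePreserving (measurePreserving_sub_right volume y)).sub hfm).enorm).pow_const _
  · have hq : Measure.QuasiMeasurePreserving (fun z : RN N × RN N => z.1 - z.2)
        (volume.prod volume) volume := quasiMeasurePreserving_sub volume volume
    exact (hkm.comp measurable_snd).aemeasurable.mul
      (((hfm.comp_quasiMeasurePreserving hq).sub
        (hfm.comp_quasiMeasurePreserving Measure.quasiMeasurePreserving_fst)).enorm.pow_const _)

theorem tendsto_eLpNorm_convolution_sub [NormedSpace ℝ F] [CompleteSpace F] {p : ℝ} (hp : 1 ≤ p)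
    {φ : ℕ → ContDiffBump (0 : RN N)}
    (hφ : Tendsto (fun n => (φ n).rOut) atTop (𝓝 0)) {f : RN N → F}
    (hf : MemLp f (ENNReal.ofReal p) volume) :
    Tendsto (fun n => eLpNorm (fun x => ((φ n).normed volume ⋆[lsmul ℝ ℝ, volume] f) x - f x)
      (ENNReal.ofReal p) volume) atTop (𝓝 0) := by
  have hp0 : 0 < p := by linarith
  have hp1 : (1 : ℝ≥0∞) ≤ ENNReal.ofReal p := by simpa using hp
  have hne : ENNReal.ofReal p ≠ 0 := by simpa using hp0
  have hloc : LocallyIntegrable f volume := hf.locallyIntegrable hp1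
  have htr := tendsto_eLpNorm_translate_sub hp1 ENNReal.ofReal_ne_top hf
  rw [ENNReal.tendsto_nhds_zero] at htr ⊢
  intro ε hε
  obtain ⟨δ, hδ, hball⟩ := Metric.eventually_nhds_iff_ball.1 (htr ε hε)
  filter_upwards [hφ.eventually (gt_mem_nhds hδ)] with n hn
  have hpe : (ENNReal.ofReal p).toReal = p := ENNReal.toReal_ofReal hp0.le
  simp only [eLpNorm_eq_lintegral_rpow_enorm_toReal hne ENNReal.ofReal_ne_top, hpe] at hball ⊢
  rw [one_div, ENNReal.rpow_inv_le_iff hp0]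
  refine (lintegral_convolution_sub_rpow_le hp (φ n) hloc).trans ?_
  have : ∀ y, ‖(φ n).normed volume y‖ₑ * ∫⁻ x, ‖f (x - y) - f x‖ₑ ^ p ≤
      ‖(φ n).normed volume y‖ₑ * ε ^ p := by
    intro y
    by_cases hy : y ∈ Metric.ball (0 : RN N) δ
    · gcongr
      have := hball y hy
      rwa [one_div, ENNReal.rpow_inv_le_iff hp0] at this
    · have : (φ n).normed volume y = 0 := by
        by_contra h
        have h1 : y ∈ Function.support ((φ n).normed volume) := h
        rw [(φ n).support_normed_eq] at h1
        exact hy (Metric.ball_subset_ball hn.le h1)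
      simp [this]
  refine (lintegral_mono this).trans (le_of_eq ?_)
  rw [lintegral_mul_const _ (φ n).continuous_normed.measurable.enorm]
  have h2 := ofReal_integral_norm_eq_lintegral_enorm
    ((φ n).integrable_normed (μ := (volume : Measure (RN N))))
  rw [← h2]
  simp only [Real.norm_eq_abs, abs_of_nonneg ((φ n).nonneg_normed _), (φ n).integral_normed,
    ENNReal.ofReal_one, one_mul]

end Mollification

/-! ### Smooth approximation of weakly differentiable functions -/

section SmoothApproximation

open Filter Topology ContinuousLinearMap
open scoped ENNReal Convolution

variable {N : ℕ}

theorem gradient_apply {f : RN N → ℝ} {x : RN N} (i : Fin N) :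
    gradient f x i = fderiv ℝ f x (EuclideanSpace.single i 1) := by
  rw [← inner_gradient_left, EuclideanSpace.inner_single_right]
  simp

/-- The derivative is put on the kernel, and `y ↦ φ (x - y)` is used as a test function for the weak
gradient. It is supported in the ball of radius `rOut` about `x`, hence in `K`, so truncating to `K`
changes nothing. The sign from the reflection cancels the one from integration by parts. -/
theorem HasWeakGradient.gradient_convolution {Ω : Set (RN N)} {u : RN N → ℝ} {G : RN N → RN N}
    (hG : HasWeakGradient Ω u G) (hΩ : MeasurableSet Ω) {K : Set (RN N)} (hK : IsCompact K)
    (hKΩ : K ⊆ Ω) (φ : ContDiffBump (0 : RN N)) {x : RN N}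
    (hx : Metric.closedBall x φ.rOut ⊆ K) :
    gradient (φ.normed volume ⋆[lsmul ℝ ℝ, volume] K.indicator u) x =
      (φ.normed volume ⋆[lsmul ℝ ℝ, volume] K.indicator G) x := by
  have hKm := hK.measurableSet
  have hui : Integrable (K.indicator u) volume :=
    (hG.locallyIntegrableOn.mono_set hKΩ |>.integrableOn_isCompact hK).integrable_indicator hKm
  have hGi : Integrable (K.indicator G) volume :=
    (hG.locallyIntegrableOn_gradient.mono_set hKΩ |>.integrableOn_isCompact hK).integrable_indicator
      hKm
  have hφs : ContDiff ℝ ∞ (φ.normed (volume : Measure (RN N))) := φ.contDiff_normed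
  have hφ1 : ContDiff ℝ 1 (φ.normed (volume : Measure (RN N))) := φ.contDiff_normed
  have hcs := φ.hasCompactSupport_normed (μ := (volume : Measure (RN N)))
  ext i
  have hd := hcs.hasFDerivAt_convolution_left (lsmul ℝ ℝ) hφ1 hui.locallyIntegrable x
  rw [gradient_apply, hd.fderiv]
  set ψ : RN N → ℝ := fun y => φ.normed volume (x - y) with hψ
  have hsupp : tsupport ψ ⊆ K := by
    refine (closure_minimal ?_ Metric.isClosed_closedBall).trans hx
    intro y hy
    have h1 : x - y ∈ Function.support (φ.normed (volume : Measure (RN N))) := hy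
    rw [φ.support_normed_eq, mem_ball_zero_iff] at h1
    rw [Metric.mem_closedBall, dist_comm, dist_eq_norm]
    exact h1.le
  have hψt : IsTestFunction Ω ψ :=
    { smooth := hφs.comp (contDiff_const.sub contDiff_id)
      hasCompactSupport := hK.of_isClosed_subset (isClosed_tsupport ψ) hsupp
      tsupport_subset := hsupp.trans hKΩ }
  have hψd : ∀ y, fderiv ℝ ψ y (EuclideanSpace.single i 1) =
      - fderiv ℝ (φ.normed volume) (x - y) (EuclideanSpace.single i 1) := by
    intro y
    have h1 : HasFDerivAt ψ _ y := ((hφ1.differentiable one_ne_zero (x - y)).hasFDerivAt).comp y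
      ((hasFDerivAt_const x y).sub (hasFDerivAt_id y))
    rw [h1.fderiv]
    simp
  have key := hG.integral_eq ψ hψt i
  have hz : ∀ y ∉ K, ψ y = 0 := fun y hy => image_eq_zero_of_notMem_tsupport fun h => hy (hsupp h)
  have hz' : ∀ y ∉ K, fderiv ℝ ψ y = 0 := fun y hy =>
    image_eq_zero_of_notMem_tsupport fun h => hy (hsupp (tsupport_fderiv_subset ℝ h))
  have hc1 := (hcs.fderiv ℝ).convolutionExists_left ((lsmul ℝ ℝ).precompL (RN N))
    (hφ1.continuous_fderiv one_ne_zero) hui.locallyIntegrable x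
  have hc2 := hcs.convolutionExists_left (lsmul ℝ ℝ) hφ1.continuous hGi.locallyIntegrable x
  have hl : (fderiv ℝ (φ.normed volume) ⋆[(lsmul ℝ ℝ).precompL (RN N), volume] K.indicator u) x
      (EuclideanSpace.single i 1) = - ∫ y in Ω, u y * fderiv ℝ ψ y (EuclideanSpace.single i 1) := by
    rw [convolution_eq_swap, ContinuousLinearMap.integral_apply hc1.integrable_swap,
      ← integral_neg, ← integral_indicator hΩ]
    refine integral_congr_ae (Eventually.of_forall fun y => ?_)
    by_cases hy : y ∈ K
    · simp [hy, hKΩ hy, hψd, mul_comm]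
    · by_cases hyΩ : y ∈ Ω <;> simp [hy, hyΩ, hz']
  have hr : (φ.normed volume ⋆[lsmul ℝ ℝ, volume] K.indicator G) x i = ∫ y in Ω, G y i * ψ y := by
    rw [convolution_eq_swap]
    change EuclideanSpace.proj (𝕜 := ℝ) i (∫ y, lsmul ℝ ℝ (φ.normed volume (x - y)) (K.indicator G y)) = _
    rw [← ContinuousLinearMap.integral_comp_comm _ hc2.integrable_swap, ← integral_indicator hΩ]
    refine integral_congr_ae (Eventually.of_forall fun y => ?_)
    by_cases hy : y ∈ K
    · simp [hy, hKΩ hy, hψ, mul_comm]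
    · by_cases hyΩ : y ∈ Ω <;> simp [hy, hyΩ, hz]
  rw [hl, hr, key, neg_neg]

/-- Interior approximation of a locally bounded weakly differentiable function by uniformly bounded
smooth functions whose gradients converge in `L^p`. -/
theorem HasWeakGradient.exists_smooth_approx {p : ℝ} (hp : 1 < p) {Ω : Set (RN N)} (hΩ : IsOpen Ω)
    {S : Set (RN N)} (hS : IsCompact S) (hSΩ : S ⊆ Ω) {u : RN N → ℝ} {G : RN N → RN N}
    (hG : HasWeakGradient Ω u G) (hu : EssLocallyBounded Ω u) (hGp : MemLpLoc p Ω G) :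
    ∃ (w : ℕ → RN N → ℝ) (M : ℝ), (∀ n, ContDiff ℝ ∞ (w n)) ∧ (∀ n x, |w n x| ≤ M) ∧
      (∀ᵐ x ∂volume.restrict S, Tendsto (fun n => w n x) atTop (𝓝 (u x))) ∧
      Tendsto (fun n => eLpNorm (fun x => gradient (w n) x - G x) (ENNReal.ofReal p)
        (volume.restrict S)) atTop (𝓝 0) := by
  obtain ⟨δ, hδ, hKΩ⟩ := hS.exists_cthickening_subset_open hΩ hSΩ
  set K := Metric.cthickening δ S with hKdef
  have hK : IsCompact K := hS.cthickening
  have hKm := hK.measurableSet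
  have hui : Integrable (K.indicator u) volume :=
    (hG.locallyIntegrableOn.mono_set hKΩ |>.integrableOn_isCompact hK).integrable_indicator hKm
  have hGi : MemLp (K.indicator G) (ENNReal.ofReal p) volume :=
    (memLp_indicator_iff_restrict hKm).2 (hGp K hK hKΩ)
  obtain ⟨M, hM⟩ := hu K hK hKΩ
  have hM' : ∀ᵐ x, ‖K.indicator u x‖ ≤ max M 0 := by
    filter_upwards [(ae_restrict_iff' hKm).1 hM] with x hx
    by_cases hxK : x ∈ K
    · simpa [hxK] using Or.inl (hx hxK)
    · simp [hxK]
  have hrp : ∀ n : ℕ, 0 < δ / (n + 1) := fun n => by positivity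
  -- Outer radii at most `δ` keep the convolution at points of `S` inside the thickening `K`. The
  -- fixed ratio 2 of outer to inner radius is what almost everywhere convergence, by Lebesgue
  -- differentiation, requires.
  let φ : ℕ → ContDiffBump (0 : RN N) := fun n =>
    ⟨δ / (n + 1) / 2, δ / (n + 1), half_pos (hrp n), half_lt_self (hrp n)⟩
  have hφ : Tendsto (fun n => (φ n).rOut) atTop (𝓝 0) := by
    have := tendsto_one_div_add_atTop_nhds_zero_nat (𝕜 := ℝ) |>.const_mul δ
    simpa [φ, div_eq_mul_inv] using this
  have hφδ : ∀ n, (φ n).rOut ≤ δ := fun n =>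
    div_le_self hδ.le (by have : (0 : ℝ) ≤ n := n.cast_nonneg; linarith)
  refine ⟨fun n => (φ n).normed volume ⋆[lsmul ℝ ℝ, volume] K.indicator u, max M 0, fun n => ?_,
    fun n x => ?_, ?_, ?_⟩
  · exact (φ n).hasCompactSupport_normed.contDiff_convolution_left (lsmul ℝ ℝ)
      (φ n).contDiff_normed hui.locallyIntegrable
  · have h1 : ∀ᵐ y, ‖K.indicator u (x - y)‖ ≤ max M 0 :=
      (Measure.measurePreserving_sub_left volume x).quasiMeasurePreserving.ae hM'
    change ‖((φ n).normed volume ⋆[lsmul ℝ ℝ, volume] K.indicator u) x‖ ≤ _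
    rw [convolution_def]
    refine (norm_integral_le_of_norm_le (((φ n).integrable_normed).mul_const (max M 0)) ?_).trans ?_
    · filter_upwards [h1] with y hy
      rw [lsmul_apply, norm_smul, Real.norm_eq_abs, abs_of_nonneg ((φ n).nonneg_normed y)]
      exact mul_le_mul_of_nonneg_left hy ((φ n).nonneg_normed y)
    · rw [integral_mul_const, (φ n).integral_normed, one_mul]
  · have h1 := ContDiffBump.ae_convolution_tendsto_right_of_locallyIntegrable (K := 2) hφ
      (Eventually.of_forall fun n => le_of_eq (by simp [φ]; ring)) hui.locallyIntegrable
    rw [ae_restrict_iff' hS.measurableSet]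
    filter_upwards [h1] with x hx hxS
    rwa [Set.indicator_of_mem (Metric.self_subset_cthickening S hxS)] at hx
  · have h1 := tendsto_eLpNorm_convolution_sub hp.le hφ hGi
    refine tendsto_of_tendsto_of_tendsto_of_le_of_le tendsto_const_nhds h1 (fun _ => zero_le)
      fun n => ?_
    refine le_trans (le_of_eq (eLpNorm_congr_ae ?_)) (eLpNorm_mono_measure _ Measure.restrict_le_self)
    rw [Filter.EventuallyEq, ae_restrict_iff' hS.measurableSet]
    refine Eventually.of_forall fun x hx => ?_
    have hb : Metric.closedBall x (φ n).rOut ⊆ K :=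
      (Metric.closedBall_subset_closedBall (hφδ n)).trans
        (Metric.closedBall_subset_cthickening hx δ)
    rw [hG.gradient_convolution hΩ.measurableSet hK hKΩ (φ n) hb,
      Set.indicator_of_mem (Metric.self_subset_cthickening S hx)]

end SmoothApproximation

/-! ### Calculus of approximable functions -/

section ApproxBy

open Filter Topology
open scoped ENNReal

variable {N : ℕ}

/-- The smooth functions `f n` converge to `w` almost everywhere in `S`, and their gradients
converge to `W` in `L^p(S)`. -/
structure ApproxBy (p : ℝ) (S : Set (RN N)) (f : ℕ → RN N → ℝ) (w : RN N → ℝ)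
    (W : RN N → RN N) : Prop where
  smooth : ∀ n, ContDiff ℝ ∞ (f n)
  ae_tendsto : ∀ᵐ x ∂volume.restrict S, Tendsto (fun n => f n x) atTop (𝓝 (w x))
  tendsto_gradient : Tendsto (fun n => eLpNorm (fun x => gradient (f n) x - W x)
    (ENNReal.ofReal p) (volume.restrict S)) atTop (𝓝 0)

theorem enorm_gradient {f : RN N → ℝ} (x : RN N) : ‖gradient f x‖ₑ = ‖fderiv ℝ f x‖ₑ := by
  simp only [← ofReal_norm, gradient, LinearIsometryEquiv.norm_map]

theorem norm_gradient {f : RN N → ℝ} (x : RN N) : ‖gradient f x‖ = ‖fderiv ℝ f x‖ := by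
  simp only [gradient, LinearIsometryEquiv.norm_map]

theorem ContDiff.continuous_gradient {f : RN N → ℝ} {n : WithTop ℕ∞} (hf : ContDiff ℝ n f)
    (hn : n ≠ 0) : Continuous (gradient f) :=
  (InnerProductSpace.toDual ℝ (RN N)).symm.continuous.comp (hf.continuous_fderiv hn)

theorem gradient_mul_comp {η w : RN N → ℝ} {T : ℝ → ℝ} {x : RN N} (hη : DifferentiableAt ℝ η x)
    (hw : DifferentiableAt ℝ w x) (hT : DifferentiableAt ℝ T (w x)) :
    gradient (fun x => η x * T (w x)) x =
      T (w x) • gradient η x + (η x * deriv T (w x)) • gradient w x := by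
  have h1 : HasFDerivAt (fun x => η x * T (w x)) _ x :=
    hη.hasFDerivAt.mul (hT.hasDerivAt.comp_hasFDerivAt x hw.hasFDerivAt)
  rw [gradient, h1.fderiv]
  simp only [gradient, map_add, map_smul, smul_smul]
  rw [add_comm]

theorem ApproxBy.mono {p : ℝ} {S S' : Set (RN N)} {f : ℕ → RN N → ℝ} {w : RN N → ℝ}
    {W : RN N → RN N} (h : ApproxBy p S f w W) (hS : S' ⊆ S) : ApproxBy p S' f w W where
  smooth := h.smooth
  ae_tendsto := ae_restrict_of_ae_restrict_of_subset hS h.ae_tendsto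
  tendsto_gradient := tendsto_of_tendsto_of_tendsto_of_le_of_le tendsto_const_nhds
    h.tendsto_gradient (fun _ => zero_le) fun _ =>
      eLpNorm_mono_measure _ (Measure.restrict_mono hS le_rfl)

theorem ApproxBy.aestronglyMeasurable {p : ℝ} {S : Set (RN N)} {f : ℕ → RN N → ℝ} {w : RN N → ℝ}
    {W : RN N → RN N} (h : ApproxBy p S f w W) : AEStronglyMeasurable w (volume.restrict S) :=
  aestronglyMeasurable_of_tendsto_ae atTop
    (fun n => (h.smooth n).continuous.aestronglyMeasurable) h.ae_tendsto

theorem tendsto_eLpNorm_zero_of_dominated {α E : Type*} [MeasurableSpace α] {μ : Measure α}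
    [NormedAddCommGroup E] {p : ℝ} (hp : 0 < p) {X : ℕ → α → E} {g : α → ℝ}
    (hX : ∀ n, AEStronglyMeasurable (X n) μ) (hg : MemLp g (ENNReal.ofReal p) μ)
    (hb : ∀ n, ∀ᵐ x ∂μ, ‖X n x‖ ≤ g x) (hlim : ∀ᵐ x ∂μ, Tendsto (fun n => X n x) atTop (𝓝 0)) :
    Tendsto (fun n => eLpNorm (X n) (ENNReal.ofReal p) μ) atTop (𝓝 0) := by
  have hne : ENNReal.ofReal p ≠ 0 := by simpa using hp
  have hpe : (ENNReal.ofReal p).toReal = p := ENNReal.toReal_ofReal hp.le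
  have hfin := lintegral_rpow_enorm_lt_top_of_eLpNorm_lt_top hne ENNReal.ofReal_ne_top hg.2
  rw [hpe] at hfin
  have key : Tendsto (fun n => ∫⁻ x, ‖X n x‖ₑ ^ p ∂μ) atTop (𝓝 (∫⁻ _, 0 ∂μ)) := by
    refine tendsto_lintegral_of_dominated_convergence' (fun x => ‖g x‖ₑ ^ p)
      (fun n => (hX n).enorm.pow_const p) (fun n => ?_) hfin.ne ?_
    · filter_upwards [hb n] with x hx
      gcongr
      rw [← ofReal_norm, ← ofReal_norm]
      exact ENNReal.ofReal_le_ofReal (hx.trans (le_abs_self _))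
    · filter_upwards [hlim] with x hx
      have h0 := (ENNReal.continuous_rpow_const (y := p)).tendsto 0
      rw [ENNReal.zero_rpow_of_pos hp] at h0
      refine h0.comp ?_
      have := (continuous_enorm.tendsto (0 : E)).comp hx
      simpa [Function.comp_def] using this
  simp only [eLpNorm_eq_lintegral_rpow_enorm_toReal hne ENNReal.ofReal_ne_top, hpe]
  have h0 := (ENNReal.continuous_rpow_const (y := 1 / p)).tendsto 0
  rw [ENNReal.zero_rpow_of_pos (by positivity)] at h0
  rw [lintegral_zero] at key
  exact h0.comp key

theorem memLp_const_add_mul_norm {p : ℝ} {S : Set (RN N)} (hS : IsCompact S) {G : RN N → RN N}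
    (hG : MemLp G (ENNReal.ofReal p) (volume.restrict S)) (a b : ℝ) :
    MemLp (fun x => a + b * ‖G x‖) (ENNReal.ofReal p) (volume.restrict S) := by
  have : IsFiniteMeasure (volume.restrict S) := ⟨by simpa using hS.measure_lt_top⟩
  exact (memLp_const a).add (hG.norm.const_mul b)

theorem exists_forall_abs_le_of_continuous {T : ℝ → ℝ} (hT : Continuous T) (M : ℝ) :
    ∃ C, 0 ≤ C ∧ ∀ s, |s| ≤ M → |T s| ≤ C := by
  obtain ⟨C, hC⟩ := (isCompact_Icc (a := -M) (b := M)).exists_bound_of_continuousOn hT.continuousOn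
  refine ⟨max C 0, le_max_right _ _, fun s hs => (hC s (abs_le.1 hs)).trans (le_max_left _ _)⟩

theorem ApproxBy.ae_abs_le {p : ℝ} {S : Set (RN N)} {f : ℕ → RN N → ℝ} {u : RN N → ℝ}
    {G : RN N → RN N} (h : ApproxBy p S f u G) {M : ℝ} (hM : ∀ n x, |f n x| ≤ M) :
    ∀ᵐ x ∂volume.restrict S, |u x| ≤ M := by
  filter_upwards [h.ae_tendsto] with x hx
  exact le_of_tendsto hx.abs (Eventually.of_forall fun n => hM n x)

/-- This supplies the nonlinear test functions `η T(u)`. The uniform bound on the approximants lets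
`T` be any smooth function: only its values on `[-M, M]` matter. -/
theorem ApproxBy.mul_comp {p : ℝ} (hp : 1 < p) {S : Set (RN N)} (hS : IsCompact S)
    {f : ℕ → RN N → ℝ} {u : RN N → ℝ} {G : RN N → RN N} (h : ApproxBy p S f u G) {M : ℝ}
    (hM : ∀ n x, |f n x| ≤ M) (hG : MemLp G (ENNReal.ofReal p) (volume.restrict S))
    {η : RN N → ℝ} (hη : ContDiff ℝ ∞ η) {T : ℝ → ℝ} (hT : ContDiff ℝ ∞ T) :
    ApproxBy p S (fun n x => η x * T (f n x)) (fun x => η x * T (u x))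
      (fun x => T (u x) • gradient η x + (η x * deriv T (u x)) • G x) := by
  have hinf : (∞ : WithTop ℕ∞) ≠ 0 := by simp
  have hTd : Continuous (deriv T) := hT.continuous_deriv (by simp)
  have hgη := hη.continuous_gradient hinf
  obtain ⟨C₀, hC₀, hT0⟩ := exists_forall_abs_le_of_continuous hT.continuous M
  obtain ⟨C₁, hC₁, hT1⟩ := exists_forall_abs_le_of_continuous hTd M
  obtain ⟨E₀, hE₀⟩ := hS.exists_bound_of_continuousOn hη.continuous.continuousOn
  obtain ⟨E₁, hE₁⟩ := hS.exists_bound_of_continuousOn hgη.continuousOn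
  have hSm := hS.measurableSet
  have hum := h.aestronglyMeasurable
  have huM := h.ae_abs_le hM
  have hfs := fun n => (h.smooth n).continuous
  refine ⟨fun n => hη.mul (hT.comp (h.smooth n)), ?_, ?_⟩
  · filter_upwards [h.ae_tendsto] with x hx
    exact ((hT.continuous.tendsto _).comp hx).const_mul _
  -- The gradient error splits in two: `X` carries the errors in `T` and its derivative against the
  -- fixed fields and vanishes by dominated convergence; `Y` is a bounded factor times the gradient
  -- error of `f n`.
  let X : ℕ → RN N → RN N := fun n x => (T (f n x) - T (u x)) • gradient η x +
    (η x * (deriv T (f n x) - deriv T (u x))) • G x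
  let Y : ℕ → RN N → RN N := fun n x => (η x * deriv T (f n x)) • (gradient (f n) x - G x)
  have hTu := hT.continuous.comp_aestronglyMeasurable hum
  have hTdu := hTd.comp_aestronglyMeasurable hum
  have hXm : ∀ n, AEStronglyMeasurable (X n) (volume.restrict S) := fun n =>
    (((hT.continuous.comp (hfs n)).aestronglyMeasurable.sub hTu).smul
      hgη.aestronglyMeasurable).add ((hη.continuous.aestronglyMeasurable.mul
        ((hTd.comp (hfs n)).aestronglyMeasurable.sub hTdu)).smul hG.1)
  have hYm : ∀ n, AEStronglyMeasurable (Y n) (volume.restrict S) := fun n =>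
    ((hη.continuous.mul (hTd.comp (hfs n))).aestronglyMeasurable).smul
      (((h.smooth n).continuous_gradient hinf).aestronglyMeasurable.sub hG.1)
  have hXY : ∀ n, (fun x => gradient (fun x => η x * T (f n x)) x -
      (T (u x) • gradient η x + (η x * deriv T (u x)) • G x)) = X n + Y n := by
    intro n
    ext1 x
    rw [gradient_mul_comp (hη.differentiable hinf x) ((h.smooth n).differentiable hinf x)
      (hT.differentiable hinf _)]
    simp only [X, Y, Pi.add_apply]
    module
  have hX0 : Tendsto (fun n => eLpNorm (X n) (ENNReal.ofReal p) (volume.restrict S)) atTop (𝓝 0) := by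
    refine tendsto_eLpNorm_zero_of_dominated (by linarith) hXm
      (memLp_const_add_mul_norm hS hG (2 * C₀ * E₁) (E₀ * (2 * C₁))) (fun n => ?_) ?_
    · filter_upwards [huM, ae_restrict_mem hSm] with x hx hxS
      have a1 : |T (f n x) - T (u x)| ≤ 2 * C₀ := by
        have := hT0 _ (hM n x); have := hT0 _ hx
        exact (abs_sub _ _).trans (by linarith)
      have a2 : |deriv T (f n x) - deriv T (u x)| ≤ 2 * C₁ := by
        have := hT1 _ (hM n x); have := hT1 _ hx
        exact (abs_sub _ _).trans (by linarith)
      have e0 := hE₀ x hxS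
      have e1 := hE₁ x hxS
      have e00 := (norm_nonneg _).trans e0
      refine (norm_add_le _ _).trans ?_
      rw [norm_smul, norm_smul, norm_mul]
      simp only [Real.norm_eq_abs] at *
      gcongr
    · filter_upwards [h.ae_tendsto] with x hx
      have b1 := ((hT.continuous.tendsto _).comp hx).sub_const (T (u x))
      have b2 := (((hTd.tendsto _).comp hx).sub_const (deriv T (u x))).const_mul (η x)
      have b3 := (b1.smul_const (gradient η x)).add (b2.smul_const (G x))
      simpa [X] using b3
  have hY0 : Tendsto (fun n => eLpNorm (Y n) (ENNReal.ofReal p) (volume.restrict S)) atTop (𝓝 0) := by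
    have h1 := ENNReal.Tendsto.const_mul h.tendsto_gradient
      (Or.inr (ENNReal.ofReal_ne_top (r := E₀ * C₁)))
    rw [mul_zero] at h1
    refine tendsto_of_tendsto_of_tendsto_of_le_of_le tendsto_const_nhds h1 (fun _ => zero_le)
      fun n => eLpNorm_le_mul_eLpNorm_of_ae_le_mul ?_ _
    filter_upwards [ae_restrict_mem hSm] with x hxS
    rw [norm_smul, norm_mul]
    have e0 := hE₀ x hxS
    have e00 := (norm_nonneg _).trans e0
    gcongr
    exact hT1 _ (hM n x)
  simp only [hXY]
  refine tendsto_of_tendsto_of_tendsto_of_le_of_le tendsto_const_nhds (by simpa using hX0.add hY0)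
    (fun _ => zero_le) fun n => eLpNorm_add_le (hXm n) (hYm n) (by simpa using hp.le)

end ApproxBy

/-! ### Passing to the limit in Sobolev's inequality and in the equation -/

section Inequalities

open Filter Topology
open scoped ENNReal NNReal

variable {N : ℕ}

theorem ApproxBy.tendsto_lintegral_enorm_sub {p : ℝ} (hp : 1 < p) {S : Set (RN N)}
    (hS : volume S ≠ ⊤) {f : ℕ → RN N → ℝ} {w : RN N → ℝ} {W : RN N → RN N}
    (h : ApproxBy p S f w W) (hW : AEStronglyMeasurable W (volume.restrict S)) :
    Tendsto (fun n => ∫⁻ x in S, ‖gradient (f n) x - W x‖ₑ) atTop (𝓝 0) := by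
  have hinf : (∞ : WithTop ℕ∞) ≠ 0 := by simp
  have hp1 : (1 : ℝ≥0∞) ≤ ENNReal.ofReal p := by simpa using hp.le
  have h1 := ENNReal.Tendsto.mul_const h.tendsto_gradient (Or.inr
    (ENNReal.rpow_ne_top_of_nonneg (y := 1 / (1 : ℝ≥0∞).toReal - 1 / (ENNReal.ofReal p).toReal)
      (by rw [ENNReal.toReal_ofReal (by linarith)]; simp; exact inv_le_one_of_one_le₀ hp.le) hS))
  rw [zero_mul] at h1
  refine tendsto_of_tendsto_of_tendsto_of_le_of_le tendsto_const_nhds h1 (fun _ => zero_le)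
    fun n => ?_
  have := eLpNorm_le_eLpNorm_mul_rpow_measure_univ hp1
    ((((h.smooth n).continuous_gradient hinf).aestronglyMeasurable.sub hW) :
      AEStronglyMeasurable (fun x => gradient (f n) x - W x) (volume.restrict S))
  rwa [eLpNorm_one_eq_lintegral_enorm, Measure.restrict_apply_univ] at this

theorem lintegral_gradient_le {f : RN N → ℝ} {W : RN N → RN N} {S : Set (RN N)}
    (hW : AEStronglyMeasurable W (volume.restrict S)) :
    ∫⁻ x in S, ‖gradient f x‖ₑ ≤
      (∫⁻ x in S, ‖W x‖ₑ) + ∫⁻ x in S, ‖gradient f x - W x‖ₑ := by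
  rw [← lintegral_add_left' hW.enorm]
  refine lintegral_mono fun x => ?_
  calc ‖gradient f x‖ₑ = ‖W x + (gradient f x - W x)‖ₑ := by rw [add_sub_cancel]
    _ ≤ _ := enorm_add_le _ _

/-- The `L¹` Sobolev inequality for compactly supported approximable functions. -/
theorem ApproxBy.sobolev {p q : ℝ} (hp : 1 < p) (hq : (N : ℝ).HolderConjugate q) {S : Set (RN N)}
    (hS : IsCompact S) {f : ℕ → RN N → ℝ} {w : RN N → ℝ} {W : RN N → RN N}
    (h : ApproxBy p S f w W) (hW : AEStronglyMeasurable W (volume.restrict S))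
    (hsupp : ∀ n, tsupport (f n) ⊆ S) :
    ∫⁻ x in S, ‖w x‖ₑ ^ q ≤
      lintegralPowLePowLIntegralFDerivConst (volume : Measure (RN N)) q *
        (∫⁻ x in S, ‖W x‖ₑ) ^ q := by
  have hq0 : 0 < q := hq.symm.pos
  set c := lintegralPowLePowLIntegralFDerivConst (volume : Measure (RN N)) q
  have h1 : ∀ n, ∫⁻ x in S, ‖f n x‖ₑ ^ q ≤
      c * ((∫⁻ x in S, ‖W x‖ₑ) + ∫⁻ x in S, ‖gradient (f n) x - W x‖ₑ) ^ q := by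
    intro n
    have hcs : HasCompactSupport (f n) := hS.of_isClosed_subset (isClosed_tsupport _) (hsupp n)
    have hg := lintegral_pow_le_pow_lintegral_fderiv (volume : Measure (RN N)) (p := q)
      ((h.smooth n).of_le (by exact_mod_cast le_top)) hcs (by simpa using hq)
    refine (setLIntegral_le_lintegral _ _).trans (hg.trans ?_)
    gcongr
    refine le_trans (le_of_eq ?_) (lintegral_gradient_le hW)
    rw [← lintegral_indicator hS.measurableSet]
    refine lintegral_congr fun x => ?_
    by_cases hx : x ∈ S
    · simp [hx, enorm_gradient]
    · have : fderiv ℝ (f n) x = 0 := image_eq_zero_of_notMem_tsupport fun h' =>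
        hx (hsupp n (tsupport_fderiv_subset ℝ h'))
      rw [Set.indicator_of_notMem hx, this, ← ofReal_norm, norm_zero, ENNReal.ofReal_zero]
  have hlim : Tendsto (fun n => c * ((∫⁻ x in S, ‖W x‖ₑ) +
      ∫⁻ x in S, ‖gradient (f n) x - W x‖ₑ) ^ q) atTop (𝓝 (c * (∫⁻ x in S, ‖W x‖ₑ) ^ q)) := by
    have := (h.tendsto_lintegral_enorm_sub hp hS.measure_lt_top.ne hW).const_add (∫⁻ x in S, ‖W x‖ₑ)
    rw [add_zero] at this
    exact ENNReal.Tendsto.const_mul ((ENNReal.continuous_rpow_const.tendsto _).comp this)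
      (Or.inr ENNReal.coe_ne_top)
  -- Fatou's lemma handles the left side, where only almost everywhere convergence is known; the
  -- right side converges because on a set of finite measure `L^p` convergence of gradients implies
  -- `L¹` convergence.
  calc ∫⁻ x in S, ‖w x‖ₑ ^ q = ∫⁻ x in S, liminf (fun n => ‖f n x‖ₑ ^ q) atTop := by
        refine lintegral_congr_ae ?_
        filter_upwards [h.ae_tendsto] with x hx
        exact ((((ENNReal.continuous_rpow_const (y := q)).comp continuous_enorm).tendsto
          (w x)).comp hx).liminf_eq.symm
    _ ≤ liminf (fun n => ∫⁻ x in S, ‖f n x‖ₑ ^ q) atTop :=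
        lintegral_liminf_le fun n => (h.smooth n).continuous.measurable.enorm.pow_const q
    _ ≤ liminf (fun n => c * ((∫⁻ x in S, ‖W x‖ₑ) +
          ∫⁻ x in S, ‖gradient (f n) x - W x‖ₑ) ^ q) atTop :=
        liminf_le_liminf (Eventually.of_forall h1)
    _ = _ := hlim.liminf_eq

/-- Extends the weak equation from smooth test functions to their limits: the integral of `V · W` is
minus that of `V · (∇f n - W)`, which Hölder's inequality sends to zero. -/
theorem ApproxBy.integral_inner_eq_zero {p p' : ℝ} (hp : p.HolderConjugate p') {S : Set (RN N)}
    {f : ℕ → RN N → ℝ} {w : RN N → ℝ} {W V : RN N → RN N} (h : ApproxBy p S f w W)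
    (hW : MemLp W (ENNReal.ofReal p) (volume.restrict S))
    (hV : MemLp V (ENNReal.ofReal p') (volume.restrict S))
    (h0 : ∀ n, ∫ x in S, fderiv ℝ (f n) x (V x) = 0) :
    ∫ x in S, inner ℝ (V x) (W x) = 0 := by
  have hinf : (∞ : WithTop ℕ∞) ≠ 0 := by simp
  have : ENNReal.HolderConjugate (ENNReal.ofReal p) (ENNReal.ofReal p') := hp.ennrealOfReal
  have hgm := fun n => ((h.smooth n).continuous_gradient hinf).aestronglyMeasurable
    (μ := volume.restrict S)
  have hev : ∀ᶠ n in atTop, eLpNorm (fun x => gradient (f n) x - W x) (ENNReal.ofReal p)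
      (volume.restrict S) < ⊤ := h.tendsto_gradient.eventually (gt_mem_nhds ENNReal.zero_lt_top)
  have hb : ∀ᶠ n in atTop, ‖∫ x in S, inner ℝ (V x) (W x)‖ₑ ≤
      eLpNorm (fun x => gradient (f n) x - W x) (ENNReal.ofReal p) (volume.restrict S) *
        eLpNorm V (ENNReal.ofReal p') (volume.restrict S) := by
    filter_upwards [hev] with n hn
    have hD : MemLp (fun x => gradient (f n) x - W x) (ENNReal.ofReal p) (volume.restrict S) :=
      ⟨(hgm n).sub hW.1, hn⟩
    have hint1 : Integrable (fun x => inner ℝ (V x) (W x)) (volume.restrict S) := by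
      refine (hW.norm.integrable_mul hV.norm).mono (hV.1.inner hW.1) (Eventually.of_forall fun x => ?_)
      simpa [abs_mul, mul_comm] using abs_real_inner_le_norm (V x) (W x)
    have hint2 : Integrable (fun x => inner ℝ (V x) (gradient (f n) x - W x))
        (volume.restrict S) := by
      refine (hD.norm.integrable_mul hV.norm).mono (hV.1.inner hD.1)
        (Eventually.of_forall fun x => ?_)
      simpa [abs_mul, mul_comm] using abs_real_inner_le_norm (V x) (gradient (f n) x - W x)
    have hs : (∫ x in S, inner ℝ (V x) (W x)) +
        ∫ x in S, inner ℝ (V x) (gradient (f n) x - W x) = 0 := by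
      rw [← integral_add hint1 hint2, ← h0 n]
      refine integral_congr_ae (Eventually.of_forall fun x => ?_)
      simp only [inner_sub_right, add_sub_cancel, inner_gradient_right]
      simp
    rw [eq_neg_of_add_eq_zero_left hs, enorm_neg]
    refine (enorm_integral_le_lintegral_enorm _).trans ?_
    rw [← eLpNorm_one_eq_lintegral_enorm]
    refine (eLpNorm_le_eLpNorm_mul_eLpNorm_of_nnnorm (p := ENNReal.ofReal p)
      (q := ENNReal.ofReal p') hD.1 hV.1
      (fun a b => inner ℝ b a) 1 (Eventually.of_forall fun x => ?_)).trans (by simp)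
    rw [one_mul, ← NNReal.coe_le_coe]
    simpa [mul_comm] using abs_real_inner_le_norm (V x) (gradient (f n) x - W x)
  have hlim := ENNReal.Tendsto.mul_const h.tendsto_gradient (Or.inr hV.2.ne)
  rw [zero_mul] at hlim
  have := ge_of_tendsto hlim hb
  simpa using this

end Inequalities

/-! ### A Poincaré inequality on convex sets -/

section Poincare

open Filter Topology
open scoped ENNReal NNReal

variable {N : ℕ}

/-- The homothety of ratio `t` centred at `y` maps the convex set `B` into itself, and its Jacobian
`t ^ N` is at least `2 ^ (-N)`. -/
theorem setLIntegral_comp_lineMap_le {B : Set (RN N)} (hB : Convex ℝ B) (hBm : MeasurableSet B)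
    {g : RN N → ℝ≥0∞} (hg : Measurable g) {t : ℝ} (ht : 1 / 2 ≤ t) (ht1 : t ≤ 1) {y : RN N}
    (hy : y ∈ B) :
    ∫⁻ x in B, g (y + t • (x - y)) ≤ 2 ^ N * ∫⁻ x in B, g x := by
  have ht0 : 0 < t := by linarith
  have hF : Measurable (B.indicator g) := hg.indicator hBm
  calc ∫⁻ x in B, g (y + t • (x - y)) ≤ ∫⁻ x, B.indicator g (t • x + (y - t • y)) := by
        rw [← lintegral_indicator hBm]
        refine lintegral_mono fun x => ?_
        by_cases hx : x ∈ B
        · have hmem : y + t • (x - y) ∈ B := hB.add_smul_sub_mem hy hx ⟨ht0.le, ht1⟩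
          have he : t • x + (y - t • y) = y + t • (x - y) := by module
          rw [Set.indicator_of_mem hx, he, Set.indicator_of_mem hmem]
        · simp [hx]
    _ = ∫⁻ z, B.indicator g (z + (y - t • y)) ∂(Measure.map (t • ·) volume) :=
        (lintegral_map (hF.comp (measurable_add_const (y - t • y))) (measurable_const_smul t)).symm
    _ = ENNReal.ofReal |(t ^ N)⁻¹| * ∫⁻ x in B, g x := by
        rw [Measure.map_addHaar_smul _ ht0.ne', lintegral_smul_measure, finrank_euclideanSpace_fin,
          lintegral_add_right_eq_self (B.indicator g), lintegral_indicator hBm, smul_eq_mul]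
    _ ≤ _ := by
        gcongr
        rw [abs_of_pos (by positivity), ← inv_pow, ENNReal.ofReal_pow (by positivity)]
        gcongr
        rw [show (2 : ℝ≥0∞) = ENNReal.ofReal 2 by simp]
        refine ENNReal.ofReal_le_ofReal ?_
        rw [inv_le_comm₀ ht0 two_pos]
        linarith

theorem enorm_sub_le_lintegral_gradient {f : RN N → ℝ} (hf : ContDiff ℝ ∞ f) {d : ℝ} {x y : RN N}
    (hd : ‖x - y‖ ≤ d) :
    ‖f x - f y‖ₑ ≤ ENNReal.ofReal d *
      ∫⁻ t in Set.Icc (0 : ℝ) 1, ‖gradient f (y + t • (x - y))‖ₑ := by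
  have hinf : (∞ : WithTop ℕ∞) ≠ 0 := by simp
  have hc : Continuous fun t : ℝ => fderiv ℝ f (y + t • (x - y)) (x - y) :=
    ((hf.continuous_fderiv hinf).comp (by fun_prop)).clm_apply continuous_const
  have hder : ∀ t : ℝ, HasDerivAt (fun t : ℝ => f (y + t • (x - y)))
      (fderiv ℝ f (y + t • (x - y)) (x - y)) t := by
    intro t
    have h1 : HasDerivAt (fun t : ℝ => y + t • (x - y)) (x - y) t := by
      simpa using ((hasDerivAt_id t).smul_const (x - y)).const_add y
    exact ((hf.differentiable hinf _).hasFDerivAt).comp_hasDerivAt t h1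
  have hftc := intervalIntegral.integral_eq_sub_of_hasDerivAt (a := 0) (b := 1)
    (fun t _ => hder t) (hc.intervalIntegrable 0 1)
  simp only [one_smul, zero_smul, add_zero, add_sub_cancel] at hftc
  rw [← hftc, intervalIntegral.integral_of_le zero_le_one, ← integral_Icc_eq_integral_Ioc]
  refine (enorm_integral_le_lintegral_enorm _).trans ?_
  rw [← lintegral_const_mul' _ _ ENNReal.ofReal_ne_top]
  refine lintegral_mono fun t => ?_
  rw [enorm_gradient, mul_comm]
  refine (ContinuousLinearMap.le_opENorm _ _).trans ?_
  gcongr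
  rw [← ofReal_norm]
  exact ENNReal.ofReal_le_ofReal hd

/-- The difference is integrated along the segment from `y` to `x`. At each time `t` one of `t`, `1
- t` is at least `1 / 2`; integrating first in the corresponding endpoint keeps the Jacobian bounded
below. The double integral avoids mean values. -/
theorem lintegral_lintegral_enorm_sub_le {B : Set (RN N)} (hB : Convex ℝ B) (hBm : MeasurableSet B)
    {d : ℝ} (hd : ∀ x ∈ B, ∀ y ∈ B, ‖x - y‖ ≤ d) {f : RN N → ℝ} (hf : ContDiff ℝ ∞ f) :
    ∫⁻ x in B, ∫⁻ y in B, ‖f x - f y‖ₑ ≤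
      ENNReal.ofReal d * (2 ^ N * volume B) * ∫⁻ x in B, ‖gradient f x‖ₑ := by
  have hinf : (∞ : WithTop ℕ∞) ≠ 0 := by simp
  set g : RN N → ℝ≥0∞ := fun x => ‖gradient f x‖ₑ with hgdef
  have hgc : Continuous g := (hf.continuous_gradient hinf).enorm
  have hg := hgc.measurable
  have hjm : Measurable fun z : (RN N × RN N) × ℝ => g (z.1.2 + z.2 • (z.1.1 - z.1.2)) :=
    (hgc.comp (by fun_prop)).measurable
  have hmain : ∀ t ∈ Set.Icc (0 : ℝ) 1, ∫⁻ x in B, ∫⁻ y in B, g (y + t • (x - y)) ≤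
      2 ^ N * (∫⁻ x in B, g x) * volume B := by
    intro t ht
    rcases le_total (1 / 2) t with h | h
    · rw [lintegral_lintegral_swap]
      · calc _ ≤ ∫⁻ y in B, 2 ^ N * ∫⁻ x in B, g x :=
            setLIntegral_mono measurable_const fun y hy =>
              setLIntegral_comp_lineMap_le hB hBm hg h ht.2 hy
          _ = _ := by rw [setLIntegral_const]
      · exact (hgc.comp (by fun_prop)).measurable.aemeasurable
    · calc _ ≤ ∫⁻ x in B, 2 ^ N * ∫⁻ y in B, g y := by
            refine setLIntegral_mono measurable_const fun x hx => ?_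
            have he : ∀ y, y + t • (x - y) = x + (1 - t) • (y - x) := fun y => by module
            simp only [he]
            exact setLIntegral_comp_lineMap_le hB hBm hg (by linarith) (by linarith [ht.1]) hx
        _ = _ := by rw [setLIntegral_const]
  calc ∫⁻ x in B, ∫⁻ y in B, ‖f x - f y‖ₑ
      ≤ ∫⁻ x in B, ∫⁻ y in B, ENNReal.ofReal d *
          ∫⁻ t in Set.Icc (0 : ℝ) 1, g (y + t • (x - y)) := by
        refine setLIntegral_mono' hBm fun x hx => setLIntegral_mono' hBm fun y hy => ?_
        exact enorm_sub_le_lintegral_gradient hf (hd x hx y hy)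
    _ = ENNReal.ofReal d * ∫⁻ x in B, ∫⁻ y in B, ∫⁻ t in Set.Icc (0 : ℝ) 1, g (y + t • (x - y)) := by
        simp_rw [lintegral_const_mul' _ _ ENNReal.ofReal_ne_top]
    _ = ENNReal.ofReal d * ∫⁻ z, (∫⁻ t in Set.Icc (0 : ℝ) 1, g (z.2 + t • (z.1 - z.2)))
          ∂((volume.restrict B).prod (volume.restrict B)) := by
        rw [lintegral_prod _ (Measurable.lintegral_prod_right hjm).aemeasurable]
    _ = ENNReal.ofReal d * ∫⁻ t in Set.Icc (0 : ℝ) 1, ∫⁻ x in B, ∫⁻ y in B,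
          g (y + t • (x - y)) := by
        rw [lintegral_lintegral_swap hjm.aemeasurable]
        congr 1
        refine lintegral_congr fun t => ?_
        rw [lintegral_prod]
        exact (hgc.comp (by fun_prop)).measurable.aemeasurable
    _ ≤ ENNReal.ofReal d * ∫⁻ t in Set.Icc (0 : ℝ) 1, 2 ^ N * (∫⁻ x in B, g x) * volume B := by
        gcongr ENNReal.ofReal d * ?_
        exact setLIntegral_mono measurable_const hmain
    _ = _ := by
        rw [setLIntegral_const, Real.volume_Icc]
        simp only [sub_zero, ENNReal.ofReal_one, mul_one]
        ring

theorem ApproxBy.poincare {p : ℝ} (hp : 1 < p) {B : Set (RN N)} (hB : Convex ℝ B)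
    (hBm : MeasurableSet B) (hBv : volume B ≠ ⊤) {d : ℝ} (hd : ∀ x ∈ B, ∀ y ∈ B, ‖x - y‖ ≤ d)
    {f : ℕ → RN N → ℝ} {w : RN N → ℝ} {W : RN N → RN N} (h : ApproxBy p B f w W)
    (hW : AEStronglyMeasurable W (volume.restrict B)) :
    ∫⁻ x in B, ∫⁻ y in B, ‖w x - w y‖ₑ ≤
      ENNReal.ofReal d * (2 ^ N * volume B) * ∫⁻ x in B, ‖W x‖ₑ := by
  set c := ENNReal.ofReal d * (2 ^ N * volume B)
  have hc : c ≠ ⊤ := by finiteness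
  have hfc := fun n => (h.smooth n).continuous
  have h1 : ∀ n, ∫⁻ x in B, ∫⁻ y in B, ‖f n x - f n y‖ₑ ≤
      c * ((∫⁻ x in B, ‖W x‖ₑ) + ∫⁻ x in B, ‖gradient (f n) x - W x‖ₑ) := fun n =>
    (lintegral_lintegral_enorm_sub_le hB hBm hd (h.smooth n)).trans
      (by gcongr; exact lintegral_gradient_le hW)
  have hlim : Tendsto (fun n => c * ((∫⁻ x in B, ‖W x‖ₑ) +
      ∫⁻ x in B, ‖gradient (f n) x - W x‖ₑ)) atTop (𝓝 (c * ∫⁻ x in B, ‖W x‖ₑ)) := by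
    have := (h.tendsto_lintegral_enorm_sub hp hBv hW).const_add (∫⁻ x in B, ‖W x‖ₑ)
    rw [add_zero] at this
    exact ENNReal.Tendsto.const_mul this (Or.inr hc)
  have hm : ∀ n, Measurable fun z : RN N × RN N => ‖f n z.1 - f n z.2‖ₑ := fun n =>
    (((hfc n).comp continuous_fst).sub ((hfc n).comp continuous_snd)).enorm.measurable
  calc ∫⁻ x in B, ∫⁻ y in B, ‖w x - w y‖ₑ
      ≤ ∫⁻ x in B, liminf (fun n => ∫⁻ y in B, ‖f n x - f n y‖ₑ) atTop := by
        refine lintegral_mono_ae ?_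
        filter_upwards [h.ae_tendsto] with x hx
        refine le_trans (le_of_eq ?_) (lintegral_liminf_le fun n =>
          (hm n).comp (measurable_const.prodMk measurable_id))
        refine lintegral_congr_ae ?_
        filter_upwards [h.ae_tendsto] with y hy
        exact ((continuous_enorm.tendsto _).comp (hx.sub hy)).liminf_eq.symm
    _ ≤ liminf (fun n => ∫⁻ x in B, ∫⁻ y in B, ‖f n x - f n y‖ₑ) atTop :=
        lintegral_liminf_le fun n => (hm n).lintegral_prod_right'
    _ ≤ liminf (fun n => c * ((∫⁻ x in B, ‖W x‖ₑ) +
          ∫⁻ x in B, ‖gradient (f n) x - W x‖ₑ)) atTop :=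
        liminf_le_liminf (Eventually.of_forall h1)
    _ = _ := hlim.liminf_eq

end Poincare

/-! ### Smooth steps and radial cutoffs -/

section Cutoff

open Filter Topology

/-- The value 0 is a global minimum, which covers the endpoint `t = 0` as well. -/
theorem deriv_smoothTransition_of_nonpos {t : ℝ} (ht : t ≤ 0) : deriv Real.smoothTransition t = 0 := by
  refine IsLocalMin.deriv_eq_zero (Eventually.of_forall fun s => ?_)
  rw [Real.smoothTransition.zero_of_nonpos ht]
  exact Real.smoothTransition.nonneg s

theorem deriv_smoothTransition_of_one_le {t : ℝ} (ht : 1 ≤ t) : deriv Real.smoothTransition t = 0 := by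
  refine IsLocalMax.deriv_eq_zero (Eventually.of_forall fun s => ?_)
  rw [Real.smoothTransition.one_of_one_le ht]
  exact Real.smoothTransition.le_one s

theorem exists_abs_deriv_smoothTransition_le :
    ∃ L : ℝ, 0 < L ∧ ∀ t, |deriv Real.smoothTransition t| ≤ L := by
  have hc : Continuous (deriv Real.smoothTransition) :=
    (Real.smoothTransition.contDiff (n := 1)).continuous_deriv (by simp)
  obtain ⟨C, hC⟩ := (isCompact_Icc (a := (0 : ℝ)) (b := 1)).exists_bound_of_continuousOn
    hc.continuousOn
  refine ⟨max C 1, by positivity, fun t => ?_⟩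
  rcases le_total t 0 with h | h
  · rw [deriv_smoothTransition_of_nonpos h, abs_zero]; positivity
  rcases le_total 1 t with h' | h'
  · rw [deriv_smoothTransition_of_one_le h', abs_zero]; positivity
  exact (hC t ⟨h, h'⟩).trans (le_max_left _ _)

/-- Smooth steps from `0` on `(-∞, k]` to `1` on `[k + d, ∞)` with slope at most `L / d`. -/
theorem exists_smooth_step : ∃ L : ℝ, 0 < L ∧ ∀ k d : ℝ, 0 < d → ∃ T : ℝ → ℝ,
    ContDiff ℝ ∞ T ∧ (∀ s, 0 ≤ T s ∧ T s ≤ 1) ∧ (∀ s ≤ k, T s = 0) ∧ (∀ s, k + d ≤ s → T s = 1) ∧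
      (∀ s, |deriv T s| ≤ L / d) ∧ (∀ s ≤ k, deriv T s = 0) ∧ (∀ s, k + d ≤ s → deriv T s = 0) := by
  obtain ⟨L, hL, hLb⟩ := exists_abs_deriv_smoothTransition_le
  refine ⟨L, hL, fun k d hd => ?_⟩
  have hσ : ContDiff ℝ ∞ Real.smoothTransition := Real.smoothTransition.contDiff
  have hder : ∀ s, deriv (fun s => Real.smoothTransition ((s - k) / d)) s =
      deriv Real.smoothTransition ((s - k) / d) / d := by
    intro s
    have h1 : HasDerivAt (fun s : ℝ => (s - k) / d) (1 / d) s :=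
      ((hasDerivAt_id s).sub_const k).div_const d
    have h2 := ((hσ.differentiable (by simp) ((s - k) / d)).hasDerivAt).comp s h1
    rw [show (fun s => Real.smoothTransition ((s - k) / d)) =
      Real.smoothTransition ∘ fun s => (s - k) / d from rfl, h2.deriv]
    ring
  have hlo : ∀ s ≤ k, (s - k) / d ≤ 0 := fun s hs =>
    div_nonpos_of_nonpos_of_nonneg (by linarith) hd.le
  have hhi : ∀ s, k + d ≤ s → 1 ≤ (s - k) / d := fun s hs => by
    rw [le_div_iff₀ hd]; linarith
  refine ⟨fun s => Real.smoothTransition ((s - k) / d),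
    hσ.comp ((contDiff_id.sub contDiff_const).div_const d),
    fun s => ⟨Real.smoothTransition.nonneg _, Real.smoothTransition.le_one _⟩,
    fun s hs => Real.smoothTransition.zero_of_nonpos (hlo s hs),
    fun s hs => Real.smoothTransition.one_of_one_le (hhi s hs), fun s => ?_, fun s hs => ?_,
    fun s hs => ?_⟩
  · rw [hder, abs_div, abs_of_pos hd]
    gcongr
    exact hLb _
  · rw [hder, deriv_smoothTransition_of_nonpos (hlo s hs), zero_div]
  · rw [hder, deriv_smoothTransition_of_one_le (hhi s hs), zero_div]

/-- Cutoff functions between concentric balls with gradient at most `L / (b - a)`. -/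
theorem exists_cutoff (N : ℕ) : ∃ L : ℝ, 0 < L ∧ ∀ a b : ℝ, 0 < a → a < b → ∃ η : RN N → ℝ,
    ContDiff ℝ ∞ η ∧ (∀ x, 0 ≤ η x ∧ η x ≤ 1) ∧ (∀ x ∈ Metric.closedBall (0 : RN N) a, η x = 1) ∧
      tsupport η ⊆ Metric.closedBall 0 b ∧ ∀ x, ‖gradient η x‖ ≤ L / (b - a) := by
  obtain ⟨L, hL, hLb⟩ := exists_abs_deriv_smoothTransition_le
  refine ⟨2 * L, by positivity, fun a b ha hab => ?_⟩
  have hσ : ContDiff ℝ ∞ Real.smoothTransition := Real.smoothTransition.contDiff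
  have hD : 0 < b ^ 2 - a ^ 2 := by nlinarith
  have hb : 0 < b := ha.trans hab
  -- The squared norm keeps `τ` smooth at the origin. For `‖x‖ ≤ b` its slope is at most `2 b / ((b
  -- - a) (b + a)) ≤ 2 / (b - a)`.
  set τ : RN N → ℝ := fun x => (b ^ 2 - ‖x‖ ^ 2) / (b ^ 2 - a ^ 2) with hτ
  have hτs : ContDiff ℝ ∞ τ := (contDiff_const.sub (contDiff_norm_sq ℝ)).div_const _
  have hout : ∀ x, b ≤ ‖x‖ → τ x ≤ 0 := fun x hx =>
    div_nonpos_of_nonpos_of_nonneg (by nlinarith) hD.le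
  refine ⟨fun x => Real.smoothTransition (τ x), hσ.comp hτs,
    fun x => ⟨Real.smoothTransition.nonneg _, Real.smoothTransition.le_one _⟩, fun x hx => ?_,
    closure_minimal (fun x hx => ?_) Metric.isClosed_closedBall, fun x => ?_⟩
  · rw [mem_closedBall_zero_iff] at hx
    refine Real.smoothTransition.one_of_one_le ?_
    rw [hτ, le_div_iff₀ hD]
    nlinarith [norm_nonneg x]
  · rw [mem_closedBall_zero_iff]
    by_contra h
    exact hx (Real.smoothTransition.zero_of_nonpos (hout x (not_le.1 h).le))
  · have h1 : HasFDerivAt τ _ x :=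
      (((hasStrictFDerivAt_norm_sq x).hasFDerivAt.const_sub (b ^ 2)).mul_const (b ^ 2 - a ^ 2)⁻¹)
    have h2 : HasFDerivAt (fun x => Real.smoothTransition (τ x)) _ x :=
      ((hσ.differentiable (by simp) (τ x)).hasDerivAt).comp_hasFDerivAt x h1
    rw [norm_gradient, h2.fderiv]
    rcases le_total b ‖x‖ with h | h
    · rw [deriv_smoothTransition_of_nonpos (hout x h), zero_smul, norm_zero]
      have : 0 < b - a := by linarith
      positivity
    · have hba : 0 < b - a := by linarith
      rw [← Nat.cast_smul_eq_nsmul ℝ, norm_smul, norm_smul, norm_neg, norm_smul,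
        innerSL_apply_norm, Real.norm_eq_abs, Real.norm_eq_abs, abs_of_pos (inv_pos.2 hD),
        Real.norm_natCast]
      calc |deriv Real.smoothTransition (τ x)| * ((b ^ 2 - a ^ 2)⁻¹ * ((2 : ℕ) * ‖x‖))
          ≤ L * ((b ^ 2 - a ^ 2)⁻¹ * ((2 : ℕ) * b)) := by gcongr; exact hLb _
        _ = 2 * L / (b - a) * (b / (b + a)) := by
            have : b + a ≠ 0 := by linarith
            rw [show b ^ 2 - a ^ 2 = (b - a) * (b + a) by ring]
            field_simp
            push_cast
            ring
        _ ≤ 2 * L / (b - a) * 1 := by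
            gcongr
            rw [div_le_one (by linarith)]
            linarith
        _ = _ := mul_one _

end Cutoff

/-! ### Ingredients of the Caccioppoli inequality -/

section Caccioppoli

open Filter Topology
open scoped ENNReal NNReal

variable {N : ℕ}

/-- Smooth substitutes for the positive part `(s - k)₊`. -/
theorem exists_smooth_posPart {p : ℝ} (hp : 1 < p) (k : ℝ) {h : ℝ} (hh : 0 < h) : ∃ T : ℝ → ℝ,
    ContDiff ℝ ∞ T ∧ (∀ s ≤ k, T s = 0 ∧ deriv T s = 0) ∧ (∀ s, 0 ≤ T s ∧ 0 ≤ deriv T s) ∧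
      (∀ s, k ≤ s → T s ≤ (s - k) * deriv T s ^ ((p - 1) / p)) ∧
      ∀ s, k + h ≤ s → Real.exp (-1) ≤ deriv T s := by
  have hE : ContDiff ℝ ∞ expNegInvGlue := expNegInvGlue.contDiff
  have hE' : ∀ t, 0 ≤ deriv expNegInvGlue t := fun t => expNegInvGlue.monotone.deriv_nonneg
  have hE1 : ∀ t, expNegInvGlue t ≤ 1 := by
    intro t
    rw [expNegInvGlue]
    split_ifs with ht
    · exact zero_le_one
    · rw [Real.exp_le_one_iff]
      have := inv_pos.2 (not_le.1 ht)
      linarith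
  have hE0 : ∀ t ≤ 0, deriv expNegInvGlue t = 0 := by
    intro t ht
    refine IsLocalMin.deriv_eq_zero (Eventually.of_forall fun s => ?_)
    rw [expNegInvGlue.zero_of_nonpos ht]
    exact expNegInvGlue.nonneg s
  -- Write `E` for the glue factor. For `s ≥ k` the derivative is at least `E`, and `0 ≤ E ≤ 1`
  -- gives `E ≤ E ^ ((p - 1) / p)`; so `T` is controlled by a power of its own derivative, as
  -- Young's inequality will need. Past `k + h` the factor is at least `exp (-1)`.
  set T : ℝ → ℝ := fun s => (s - k) * expNegInvGlue ((s - k) / h) with hT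
  have hder : ∀ s, deriv T s = expNegInvGlue ((s - k) / h) +
      (s - k) / h * deriv expNegInvGlue ((s - k) / h) := by
    intro s
    have h1 : HasDerivAt (fun s : ℝ => (s - k) / h) (1 / h) s :=
      ((hasDerivAt_id s).sub_const k).div_const h
    have h3 := HasDerivAt.comp s ((hE.differentiable (by simp) ((s - k) / h)).hasDerivAt) h1
    have h2 : HasDerivAt T _ s := ((hasDerivAt_id s).sub_const k).mul h3
    rw [h2.deriv]
    simp only [id]
    ring
  have hlo : ∀ s ≤ k, (s - k) / h ≤ 0 := fun s hs =>
    div_nonpos_of_nonpos_of_nonneg (by linarith) hh.le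
  have hge : ∀ s, k ≤ s → expNegInvGlue ((s - k) / h) ≤ deriv T s := by
    intro s hs
    rw [hder]
    have : 0 ≤ (s - k) / h := div_nonneg (by linarith) hh.le
    have := mul_nonneg this (hE' ((s - k) / h))
    linarith
  have hz : ∀ s ≤ k, T s = 0 ∧ deriv T s = 0 := by
    intro s hs
    rw [hder, hE0 _ (hlo s hs), hT]
    simp [expNegInvGlue.zero_of_nonpos (hlo s hs)]
  refine ⟨T, (contDiff_id.sub contDiff_const).mul
    (hE.comp ((contDiff_id.sub contDiff_const).div_const h)), hz, fun s => ?_, fun s hs => ?_,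
    fun s hs => ?_⟩
  · rcases le_total s k with hs | hs
    · rw [(hz s hs).1, (hz s hs).2]; simp
    · exact ⟨mul_nonneg (by linarith) (expNegInvGlue.nonneg _),
        (expNegInvGlue.nonneg _).trans (hge s hs)⟩
  · refine mul_le_mul_of_nonneg_left ?_ (by linarith)
    have hα : 0 ≤ (p - 1) / p := div_nonneg (by linarith) (by linarith)
    have hα1 : (p - 1) / p ≤ 1 := by rw [div_le_one (by linarith)]; linarith
    refine le_trans ?_ (Real.rpow_le_rpow (expNegInvGlue.nonneg _) (hge s hs) hα)
    exact Real.self_le_rpow_of_le_one (expNegInvGlue.nonneg _) (hE1 _) hα1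
  · have h1 : 1 ≤ (s - k) / h := by rw [le_div_iff₀ hh]; linarith
    refine le_trans ?_ ((expNegInvGlue.monotone h1).trans (hge s (by linarith)))
    simp [expNegInvGlue, not_le.2 one_pos]

/-- Either the term `c * Q` already dominates, or `Q ^ (1 / p) < P / c`, and substituting this
leaves a multiple of `P ^ p`. -/
theorem exists_young_const {p c : ℝ} (hp : 1 < p) (hc : 0 < c) : ∃ K : ℝ, 0 < K ∧
    ∀ P Q : ℝ, 0 ≤ P → 0 ≤ Q → P * Q ^ ((p - 1) / p) ≤ c * Q + K * P ^ p := by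
  have hp0 : 0 < p := by linarith
  refine ⟨(1 / c) ^ (p - 1), by positivity, fun P Q hP hQ => ?_⟩
  by_cases h : P * Q ^ ((p - 1) / p) ≤ c * Q
  · have : 0 ≤ (1 / c) ^ (p - 1) * P ^ p := by positivity
    linarith
  · have hQ0 : 0 < Q := by
      rcases hQ.eq_or_lt with rfl | h0
      · rw [Real.zero_rpow (div_pos (by linarith) hp0).ne'] at h; simp at h
      · exact h0
    have h2 : c * Q ^ (1 / p) < P := by
      have e : Q = Q ^ (1 / p) * Q ^ ((p - 1) / p) := by
        rw [← Real.rpow_add hQ0, ← add_div, add_sub_cancel, div_self hp0.ne', Real.rpow_one]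
      have hpos : 0 < Q ^ ((p - 1) / p) := by positivity
      rw [not_le] at h
      nth_rw 1 [e] at h
      rw [← mul_assoc] at h
      exact lt_of_mul_lt_mul_right h hpos.le
    have h3 : Q ^ (1 / p) ≤ 1 / c * P := by
      rw [one_div_mul_eq_div, le_div_iff₀ hc]
      linarith
    have hP0 : 0 < P := lt_of_le_of_lt (by positivity) h2
    have h4 : Q ^ ((p - 1) / p) ≤ (1 / c) ^ (p - 1) * P ^ (p - 1) := by
      rw [← Real.mul_rpow (by positivity) hP, show (p - 1) / p = 1 / p * (p - 1) by ring,
        Real.rpow_mul hQ]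
      exact Real.rpow_le_rpow (by positivity) h3 (by linarith)
    have h5 : P * P ^ (p - 1) = P ^ p := by
      rw [← Real.rpow_one_add' hP (by linarith)]; simp
    calc P * Q ^ ((p - 1) / p) ≤ P * ((1 / c) ^ (p - 1) * P ^ (p - 1)) := by gcongr
      _ = (1 / c) ^ (p - 1) * P ^ p := by rw [← h5]; ring
      _ ≤ _ := by have : 0 ≤ c * Q := by positivity
                  linarith

/-- A bounded weak solution of `div V = 0` on the closed ball of radius `R₀`, where the field `V`
obeys `p`-growth conditions relative to the gradient `G` of `u`. -/
structure IsLocalSolution (p C₀ C₁ R₀ : ℝ) (u : RN N → ℝ) (G V : RN N → RN N) : Prop where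
  measurable : Measurable u
  approx : ∃ (f : ℕ → RN N → ℝ) (M : ℝ), ApproxBy p (Metric.closedBall 0 R₀) f u G ∧
    ∀ n x, |f n x| ≤ M
  memLp_gradient : MemLp G (ENNReal.ofReal p) (volume.restrict (Metric.closedBall 0 R₀))
  aestronglyMeasurable : AEStronglyMeasurable V (volume.restrict (Metric.closedBall 0 R₀))
  coercive : ∀ᵐ x ∂volume.restrict (Metric.closedBall 0 R₀), C₀ * ‖G x‖ ^ p ≤ inner ℝ (V x) (G x)
  bounded : ∀ᵐ x ∂volume.restrict (Metric.closedBall 0 R₀), ‖V x‖ ≤ C₁ * ‖G x‖ ^ (p - 1)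
  integral_eq_zero : ∀ φ : RN N → ℝ, ContDiff ℝ ∞ φ → tsupport φ ⊆ Metric.closedBall 0 R₀ →
    ∫ x in Metric.closedBall 0 R₀, fderiv ℝ φ x (V x) = 0

/-- The part of the ball of radius `r` where `u` exceeds `k`. -/
def superlevel (u : RN N → ℝ) (k r : ℝ) : Set (RN N) := {x | k < u x} ∩ Metric.ball 0 r

theorem measurableSet_superlevel {u : RN N → ℝ} (hu : Measurable u) (k r : ℝ) :
    MeasurableSet (superlevel u k r) :=
  (measurableSet_lt measurable_const hu).inter measurableSet_ball

theorem volume_superlevel_ne_top (u : RN N → ℝ) (k r : ℝ) : volume (superlevel u k r) ≠ ⊤ :=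
  ((measure_mono Set.inter_subset_right).trans_lt measure_ball_lt_top).ne

namespace IsLocalSolution

variable {p C₀ C₁ R₀ : ℝ} {u : RN N → ℝ} {G V : RN N → RN N}

/-- Lower bounds for `u` will be upper bounds for `-u`. Retaining only the field `V` instead of `A`
makes the symmetry immediate. -/
theorem neg (h : IsLocalSolution p C₀ C₁ R₀ u G V) :
    IsLocalSolution p C₀ C₁ R₀ (fun x => -u x) (fun x => -G x) (fun x => -V x) where
  measurable := h.measurable.neg
  approx := by
    obtain ⟨f, M, hf, hM⟩ := h.approx
    refine ⟨fun n x => -f n x, M, ⟨fun n => (hf.smooth n).neg, ?_, ?_⟩, fun n x => ?_⟩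
    · filter_upwards [hf.ae_tendsto] with x hx using hx.neg
    · refine hf.tendsto_gradient.congr fun n => ?_
      rw [← eLpNorm_neg]
      congr 1
      ext1 x
      have : gradient (fun x => -f n x) x = - gradient (f n) x := by
        simp [gradient, fderiv_fun_neg]
      simp [this, Pi.neg_apply]
      abel
    · rw [abs_neg]; exact hM n x
  memLp_gradient := h.memLp_gradient.neg
  aestronglyMeasurable := h.aestronglyMeasurable.neg
  coercive := by
    filter_upwards [h.coercive] with x hx
    rwa [norm_neg, inner_neg_neg]
  bounded := by
    filter_upwards [h.bounded] with x hx
    rwa [norm_neg, norm_neg]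
  integral_eq_zero φ hφ hs := by
    simp only [map_neg, integral_neg, h.integral_eq_zero φ hφ hs, neg_zero]

/-- The growth bound and `(p - 1) p' = p` place the field in the dual exponent. -/
theorem memLp_field (h : IsLocalSolution p C₀ C₁ R₀ u G V) {p' : ℝ} (hp : p.HolderConjugate p') :
    MemLp V (ENNReal.ofReal p') (volume.restrict (Metric.closedBall 0 R₀)) := by
  have hp1 := hp.lt
  have he : ENNReal.ofReal p / ENNReal.ofReal (p - 1) = ENNReal.ofReal p' := by
    rw [← ENNReal.ofReal_div_of_pos (by linarith), hp.conjugate_eq]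
  have h1 := h.memLp_gradient.norm_rpow_div (ENNReal.ofReal (p - 1))
  rw [he, ENNReal.toReal_ofReal (by linarith)] at h1
  refine (h1.const_mul C₁).mono h.aestronglyMeasurable ?_
  filter_upwards [h.bounded] with x hx
  exact hx.trans (le_abs_self _)

end IsLocalSolution

theorem ApproxBy.memLp_mul_comp {p : ℝ} {S : Set (RN N)} (hS : IsCompact S) {f : ℕ → RN N → ℝ}
    {u : RN N → ℝ} {G : RN N → RN N} (h : ApproxBy p S f u G) {M : ℝ} (hM : ∀ n x, |f n x| ≤ M)
    (hG : MemLp G (ENNReal.ofReal p) (volume.restrict S)) {η : RN N → ℝ} (hη : ContDiff ℝ ∞ η)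
    {T : ℝ → ℝ} (hT : ContDiff ℝ ∞ T) :
    MemLp (fun x => T (u x) • gradient η x + (η x * deriv T (u x)) • G x) (ENNReal.ofReal p)
      (volume.restrict S) := by
  have hinf : (∞ : WithTop ℕ∞) ≠ 0 := by simp
  have hTd : Continuous (deriv T) := hT.continuous_deriv (by simp)
  have hgη := hη.continuous_gradient hinf
  obtain ⟨C₀, hC₀, hT0⟩ := exists_forall_abs_le_of_continuous hT.continuous M
  obtain ⟨C₁, hC₁, hT1⟩ := exists_forall_abs_le_of_continuous hTd M
  obtain ⟨E₀, hE₀⟩ := hS.exists_bound_of_continuousOn hη.continuous.continuousOn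
  obtain ⟨E₁, hE₁⟩ := hS.exists_bound_of_continuousOn hgη.continuousOn
  have hum := h.aestronglyMeasurable
  refine (memLp_const_add_mul_norm hS hG (C₀ * E₁) (E₀ * C₁)).mono
    (((hT.continuous.comp_aestronglyMeasurable hum).smul hgη.aestronglyMeasurable).add
      ((hη.continuous.aestronglyMeasurable.mul (hTd.comp_aestronglyMeasurable hum)).smul hG.1)) ?_
  filter_upwards [h.ae_abs_le hM, ae_restrict_mem hS.measurableSet] with x hx hxS
  have e0 := hE₀ x hxS
  have e1 := hE₁ x hxS
  have e00 := (norm_nonneg _).trans e0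
  refine ((norm_add_le _ _).trans ?_).trans (le_abs_self _)
  rw [norm_smul, norm_smul, norm_mul]
  gcongr
  · exact hT0 _ hx
  · exact hT1 _ hx

/-- Puts the cutoff error in the form `P * Q ^ ((p - 1) / p)`, where `Q` is the good energy density.
The power `m ≥ p` of the cutoff is there because then `m - 1 ≥ m (p - 1) / p`, so `η ^ (m - 1)` is
absorbed. -/
theorem young_integrand_le {p η T T' H Λ C₁ g : ℝ} {m : ℕ} (hp : 1 < p) (hm : p ≤ m) (hη : 0 ≤ η)
    (hη1 : η ≤ 1) (hT' : 0 ≤ T') (hTT' : T ≤ H * T' ^ ((p - 1) / p)) (hΛ : 0 ≤ Λ)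
    (hC₁ : 0 ≤ C₁) (hH : 0 ≤ H) (hg : 0 ≤ g) :
    T * (m * η ^ (m - 1) * Λ) * (C₁ * g ^ (p - 1)) ≤
      m * C₁ * Λ * H * (η ^ m * T' * g ^ p) ^ ((p - 1) / p) := by
  have hp0 : 0 < p := by linarith
  have hα : 0 ≤ (p - 1) / p := div_nonneg (by linarith) hp0.le
  have hm1 : 1 ≤ m := by
    have : (1 : ℝ) ≤ m := by linarith
    exact_mod_cast this
  have h1 : η ^ (m - 1) ≤ (η ^ m) ^ ((p - 1) / p) := by
    rw [← Real.rpow_natCast η m, ← Real.rpow_mul hη, ← Real.rpow_natCast η (m - 1)]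
    refine Real.rpow_le_rpow_of_exponent_ge' hη hη1 (by positivity) ?_
    rw [Nat.cast_sub hm1, ← mul_div_assoc, div_le_iff₀ hp0]
    push_cast
    nlinarith
  have h2 : (g ^ p) ^ ((p - 1) / p) = g ^ (p - 1) := by
    rw [← Real.rpow_mul hg, mul_div_cancel₀ _ hp0.ne']
  rw [Real.mul_rpow (by positivity) (by positivity), Real.mul_rpow (by positivity) hT', h2]
  calc T * (m * η ^ (m - 1) * Λ) * (C₁ * g ^ (p - 1))
      ≤ H * T' ^ ((p - 1) / p) * (m * (η ^ m) ^ ((p - 1) / p) * Λ) * (C₁ * g ^ (p - 1)) := by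
        gcongr
    _ = _ := by ring

end Caccioppoli

/-! ### The Caccioppoli inequality -/

section CaccioppoliInequality

open Filter Topology
open scoped ENNReal NNReal

variable {N : ℕ}

theorem norm_gradient_pow_le {η : RN N → ℝ} {x : RN N} {m : ℕ} {Λ : ℝ}
    (hη : DifferentiableAt ℝ η x) (h0 : 0 ≤ η x) (hΛ : ‖gradient η x‖ ≤ Λ) :
    ‖gradient (fun x => η x ^ m) x‖ ≤ m * η x ^ (m - 1) * Λ := by
  rw [norm_gradient] at hΛ ⊢
  have h1 : HasFDerivAt (fun x => η x ^ m) _ x := hη.hasFDerivAt.pow m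
  rw [h1.fderiv, norm_smul]
  simp only [nsmul_eq_mul, norm_mul, norm_pow, Real.norm_eq_abs, Nat.abs_cast,
    abs_of_nonneg h0]
  gcongr

theorem gradient_eq_zero_of_notMem_tsupport {f : RN N → ℝ} {x : RN N} (hx : x ∉ tsupport f) :
    gradient f x = 0 := by
  have : fderiv ℝ f x = 0 :=
    image_eq_zero_of_notMem_tsupport fun h => hx (tsupport_fderiv_subset ℝ h)
  rw [gradient, this, map_zero]

/-- The energy inequality obtained by testing the equation with `η ^ m * T(u)`. -/
theorem IsLocalSolution.energy {p C₀ C₁ R₀ : ℝ} {u : RN N → ℝ} {G V : RN N → RN N} (hp : 1 < p)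
    (hC₁ : 0 ≤ C₁) (h : IsLocalSolution p C₀ C₁ R₀ u G V) {K : ℝ}
    (hY : ∀ P Q : ℝ, 0 ≤ P → 0 ≤ Q → P * Q ^ ((p - 1) / p) ≤ C₀ / 2 * Q + K * P ^ p)
    {m : ℕ} (hm : p ≤ m) {b k H Λ : ℝ} (hb : b ≤ R₀) (hH : 0 ≤ H) (hΛ : 0 ≤ Λ)
    (hu : ∀ᵐ x ∂volume.restrict (Metric.ball (0 : RN N) b), u x ≤ k + H)
    {η : RN N → ℝ} (hη : ContDiff ℝ ∞ η) (hη0 : ∀ x, 0 ≤ η x) (hη1 : ∀ x, η x ≤ 1)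
    (hηs : tsupport η ⊆ Metric.ball 0 b) (hηg : ∀ x, ‖gradient η x‖ ≤ Λ)
    {T : ℝ → ℝ} (hT : ContDiff ℝ ∞ T) (hTk : ∀ s ≤ k, T s = 0 ∧ deriv T s = 0)
    (hT0 : ∀ s, 0 ≤ T s ∧ 0 ≤ deriv T s)
    (hT1 : ∀ s, k ≤ s → T s ≤ (s - k) * deriv T s ^ ((p - 1) / p)) :
    Integrable (fun x => η x ^ m * deriv T (u x) * ‖G x‖ ^ p)
        (volume.restrict (Metric.closedBall 0 R₀)) ∧
      C₀ / 2 * ∫ x in Metric.closedBall 0 R₀, η x ^ m * deriv T (u x) * ‖G x‖ ^ p ≤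
        K * (m * C₁ * Λ * H) ^ p * volume.real (superlevel u k b) := by
  obtain ⟨f, M, hf, hM⟩ := h.approx
  set S := Metric.closedBall (0 : RN N) R₀ with hSdef
  have hS : IsCompact S := isCompact_closedBall 0 R₀
  have hfin : IsFiniteMeasure (volume.restrict S) := ⟨by simpa using hS.measure_lt_top⟩
  have hbS : Metric.ball (0 : RN N) b ⊆ S :=
    (Metric.ball_subset_ball hb).trans Metric.ball_subset_closedBall
  have hTd : Continuous (deriv T) := hT.continuous_deriv (by simp)
  set ζ : RN N → ℝ := fun x => η x ^ m with hζ
  have hm0 : m ≠ 0 := by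
    rintro rfl
    norm_num at hm
    linarith
  have hζs : ContDiff ℝ ∞ ζ := hη.pow m
  have hζ0 : ∀ x, 0 ≤ ζ x := fun x => pow_nonneg (hη0 x) m
  have hζ1 : ∀ x, ζ x ≤ 1 := fun x => pow_le_one₀ (hη0 x) (hη1 x)
  have hζt : tsupport ζ ⊆ tsupport η :=
    closure_mono fun x hx hx' => hx (by simp only [hζ, hx', zero_pow hm0])
  have hmc := hf.mul_comp hp hS hM h.memLp_gradient hζs hT
  have hW := hf.memLp_mul_comp hS hM h.memLp_gradient hζs hT
  have hpp := Real.HolderConjugate.conjExponent hp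
  have hV := h.memLp_field hpp
  have hzero := hmc.integral_inner_eq_zero hpp hW hV fun n =>
    h.integral_eq_zero _ (hmc.smooth n)
      (((tsupport_mul_subset_left (f := ζ)).trans hζt).trans (hηs.trans hbS))
  have hGp : Integrable (fun x => ‖G x‖ ^ p) (volume.restrict S) := by
    have := h.memLp_gradient.integrable_norm_rpow (by simpa using by linarith)
      ENNReal.ofReal_ne_top
    rwa [ENNReal.toReal_ofReal (by linarith)] at this
  obtain ⟨D, hD, hDT⟩ := exists_forall_abs_le_of_continuous hTd M
  have hQi : Integrable (fun x => ζ x * deriv T (u x) * ‖G x‖ ^ p) (volume.restrict S) := by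
    refine hGp.bdd_mul (c := 1 * D) ((hζs.continuous.measurable.mul
      (hTd.measurable.comp h.measurable)).aestronglyMeasurable) ?_
    filter_upwards [hf.ae_abs_le hM] with x hx
    rw [norm_mul, Real.norm_eq_abs, Real.norm_eq_abs, abs_of_nonneg (hζ0 x)]
    exact mul_le_mul (hζ1 x) (hDT _ hx) (abs_nonneg _) zero_le_one
  refine ⟨hQi, ?_⟩
  set A := superlevel u k b with hA
  have hAm : MeasurableSet A := measurableSet_superlevel h.measurable k b
  set P := m * C₁ * Λ * H with hP
  have hP0 : 0 ≤ P := by positivity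
  have hWi : Integrable (fun x => inner ℝ (V x)
      (T (u x) • gradient ζ x + (ζ x * deriv T (u x)) • G x)) (volume.restrict S) := by
    have : ENNReal.HolderConjugate (ENNReal.ofReal p) (ENNReal.ofReal p.conjExponent) :=
      hpp.ennrealOfReal
    refine (hW.norm.integrable_mul hV.norm).mono (hV.1.inner hW.1) (Eventually.of_forall fun x => ?_)
    simpa [abs_mul, mul_comm] using abs_real_inner_le_norm (V x)
      (T (u x) • gradient ζ x + (ζ x * deriv T (u x)) • G x)
  have hAi : Integrable (A.indicator fun _ => K * P ^ p) (volume.restrict S) :=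
    (integrable_const _).indicator hAm
  -- Half of the coercive term survives Young's inequality. Off `A` the test function contributes
  -- nothing to the error: either `T` and its derivative vanish at `u x`, or `x` lies outside the
  -- support of the cutoff. Integrating finishes, since the right side has integral zero.
  have hpt : ∀ᵐ x ∂volume.restrict S, C₀ / 2 * (ζ x * deriv T (u x) * ‖G x‖ ^ p) -
      A.indicator (fun _ => K * P ^ p) x ≤ inner ℝ (V x)
        (T (u x) • gradient ζ x + (ζ x * deriv T (u x)) • G x) := by
    have hu' : ∀ᵐ x ∂volume.restrict S, x ∈ Metric.ball (0 : RN N) b → u x ≤ k + H :=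
      ae_restrict_of_ae ((ae_restrict_iff' measurableSet_ball).1 hu)
    filter_upwards [h.coercive, h.bounded, hu'] with x hco hbo hux
    by_cases hxA : x ∈ A
    · rw [Set.indicator_of_mem hxA]
      obtain ⟨hku, hxb⟩ : k < u x ∧ x ∈ Metric.ball (0 : RN N) b := hxA
      have hT1' : T (u x) ≤ H * deriv T (u x) ^ ((p - 1) / p) :=
        (hT1 _ hku.le).trans (mul_le_mul_of_nonneg_right (by linarith [hux hxb])
          (Real.rpow_nonneg (hT0 _).2 _))
      have hgζ := norm_gradient_pow_le (m := m) (hη.differentiable (by simp) x) (hη0 x) (hηg x)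
      have hyi := young_integrand_le (m := m) hp hm (hη0 x) (hη1 x) (hT0 (u x)).2 hT1' hΛ hC₁ hH
        (norm_nonneg (G x))
      have hyo := hY P (ζ x * deriv T (u x) * ‖G x‖ ^ p) hP0
        (mul_nonneg (mul_nonneg (hζ0 x) (hT0 _).2) (Real.rpow_nonneg (norm_nonneg _) _))
      have hcs : -(‖V x‖ * ‖gradient ζ x‖) ≤ inner ℝ (V x) (gradient ζ x) :=
        (abs_le.1 (abs_real_inner_le_norm _ _)).1
      have hvg : ‖V x‖ * ‖gradient ζ x‖ ≤
          C₁ * ‖G x‖ ^ (p - 1) * (m * η x ^ (m - 1) * Λ) :=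
        mul_le_mul hbo hgζ (norm_nonneg _) ((norm_nonneg _).trans hbo)
      have h1 : -(T (u x) * (m * η x ^ (m - 1) * Λ) * (C₁ * ‖G x‖ ^ (p - 1))) ≤
          T (u x) * inner ℝ (V x) (gradient ζ x) := by
        have := mul_le_mul_of_nonneg_left (hcs.trans' (neg_le_neg hvg)) (hT0 (u x)).1
        linarith
      have h2 : ζ x * deriv T (u x) * (C₀ * ‖G x‖ ^ p) ≤
          ζ x * deriv T (u x) * inner ℝ (V x) (G x) :=
        mul_le_mul_of_nonneg_left hco (mul_nonneg (hζ0 x) (hT0 _).2)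
      rw [inner_add_right, inner_smul_right, inner_smul_right]
      linarith
    · rw [Set.indicator_of_notMem hxA, sub_zero]
      by_cases hku : u x ≤ k
      · simp [hTk _ hku]
      · have hxb : x ∉ tsupport ζ := fun hx => hxA ⟨not_le.1 hku, hηs (hζt hx)⟩
        rw [gradient_eq_zero_of_notMem_tsupport hxb, image_eq_zero_of_notMem_tsupport hxb]
        simp
  have hint := integral_mono_ae ((hQi.const_mul (C₀ / 2)).sub hAi) hWi hpt
  have hAS : volume.real (A ∩ S) = volume.real A := by
    have hAS : A ⊆ S := Set.inter_subset_right.trans hbS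
    rw [Set.inter_eq_left.2 hAS]
  simp only [Pi.sub_apply] at hint
  rw [hzero, integral_sub (hQi.const_mul _) hAi, integral_const_mul,
    integral_indicator_const _ hAm, measureReal_restrict_apply hAm, hAS, smul_eq_mul] at hint
  linarith

theorem exists_caccioppoli_const (N : ℕ) {p C₀ C₁ : ℝ} (hp : 1 < p) (hC₀ : 0 < C₀)
    (hC₁ : 0 ≤ C₁) : ∃ C : ℝ, 0 < C ∧ ∀ (R₀ : ℝ) (u : RN N → ℝ) (G V : RN N → RN N),
      IsLocalSolution p C₀ C₁ R₀ u G V → ∀ a b k H : ℝ, 0 < a → a < b → b ≤ R₀ → 0 ≤ H →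
      (∀ᵐ x ∂volume.restrict (Metric.ball (0 : RN N) b), u x ≤ k + H) →
      ∫⁻ x in superlevel u k a, ‖G x‖ₑ ^ p ≤
        ENNReal.ofReal (C * (H / (b - a)) ^ p * volume.real (superlevel u k b)) := by
  obtain ⟨K, hK, hY⟩ := exists_young_const (c := C₀ / 2) hp (by positivity)
  obtain ⟨L, hL, hcut⟩ := exists_cutoff N
  obtain ⟨m, hm⟩ := exists_nat_ge p
  -- The factor `exp 1` undoes the lower bound on the derivative of `T`, `2 / C₀` the halved
  -- coercivity; `2 * L` arises because the cutoff ends at the midpoint of `a` and `b`, and `+ 1`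
  -- keeps the constant positive when `C₁ = 0`.
  refine ⟨Real.exp 1 * (2 / C₀) * K * (m * C₁ * (2 * L) + 1) ^ p, by positivity,
    fun R₀ u G V h a b k H ha hab hb hH hu => ?_⟩
  have hba : 0 < b - a := by linarith
  obtain ⟨η, hη, hη01, hηa, hηs, hηg⟩ := hcut a ((a + b) / 2) ha (by linarith)
  have hsub : tsupport η ⊆ Metric.ball 0 b :=
    hηs.trans (Metric.closedBall_subset_ball (by linarith))
  have haS : ∀ c, superlevel u c a ⊆ Metric.closedBall 0 R₀ := fun c =>
    Set.inter_subset_right.trans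
      ((Metric.ball_subset_ball (by linarith)).trans Metric.ball_subset_closedBall)
  set E := Real.exp 1 * (2 / C₀) * K * (m * C₁ * (2 * L) + 1) ^ p * (H / (b - a)) ^ p *
    volume.real (superlevel u k b) with hE
  have hstep : ∀ n : ℕ, ∫⁻ x in superlevel u (k + 1 / (n + 1)) a, ‖G x‖ₑ ^ p ≤
      ENNReal.ofReal E := by
    intro n
    have hn : (0 : ℝ) < 1 / (n + 1) := by positivity
    obtain ⟨T, hT, hTk, hT0, hT1, hTe⟩ := exists_smooth_posPart hp k hn
    obtain ⟨hi, hle⟩ := h.energy hp hC₁ hY hm hb hH (Λ := L / ((a + b) / 2 - a))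
      (div_nonneg hL.le (by linarith)) hu hη (fun x => (hη01 x).1)
      (fun x => (hη01 x).2) hsub hηg hT hTk hT0 hT1
    have hQ0 : ∀ x, 0 ≤ η x ^ m * deriv T (u x) * ‖G x‖ ^ p := fun x =>
      mul_nonneg (mul_nonneg (pow_nonneg (hη01 x).1 m) (hT0 _).2) (by positivity)
    calc ∫⁻ x in superlevel u (k + 1 / (n + 1)) a, ‖G x‖ₑ ^ p
        ≤ ∫⁻ x in superlevel u (k + 1 / (n + 1)) a, ENNReal.ofReal
            (Real.exp 1 * (η x ^ m * deriv T (u x) * ‖G x‖ ^ p)) := by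
          refine setLIntegral_mono' (measurableSet_superlevel h.measurable _ _) fun x hx => ?_
          rw [← ofReal_norm, ENNReal.ofReal_rpow_of_nonneg (norm_nonneg _) (by linarith)]
          refine ENNReal.ofReal_le_ofReal ?_
          rw [hηa x (Metric.ball_subset_closedBall hx.2), one_pow, one_mul, ← mul_assoc]
          refine le_mul_of_one_le_left (by positivity) ?_
          calc 1 = Real.exp 1 * Real.exp (-1) := by rw [← Real.exp_add]; simp
            _ ≤ _ := by gcongr; exact hTe _ (le_of_lt hx.1)
      _ ≤ ∫⁻ x in Metric.closedBall 0 R₀, ENNReal.ofReal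
            (Real.exp 1 * (η x ^ m * deriv T (u x) * ‖G x‖ ^ p)) := lintegral_mono_set (haS _)
      _ = ENNReal.ofReal (Real.exp 1 * ∫ x in Metric.closedBall 0 R₀,
            η x ^ m * deriv T (u x) * ‖G x‖ ^ p) := by
          rw [← integral_const_mul, ofReal_integral_eq_lintegral_ofReal (hi.const_mul _)
            (Eventually.of_forall fun x => mul_nonneg (Real.exp_pos 1).le (hQ0 x))]
      _ ≤ ENNReal.ofReal E := by
          refine ENNReal.ofReal_le_ofReal ?_
          have e1 : (m * C₁ * (L / ((a + b) / 2 - a)) * H) ^ p ≤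
              (m * C₁ * (2 * L) + 1) ^ p * (H / (b - a)) ^ p := by
            rw [← Real.mul_rpow (by positivity) (by positivity)]
            refine Real.rpow_le_rpow ?_ ?_ (by linarith)
            · have : 0 < (a + b) / 2 - a := by linarith
              positivity
            · have : m * C₁ * (L / ((a + b) / 2 - a)) * H = m * C₁ * (2 * L) * (H / (b - a)) := by
                rw [show (a + b) / 2 - a = (b - a) / 2 by ring]
                field_simp
              rw [this]
              gcongr
              linarith
          have e2 : ∫ x in Metric.closedBall 0 R₀, η x ^ m * deriv T (u x) * ‖G x‖ ^ p ≤
              2 / C₀ * (K * (m * C₁ * (L / ((a + b) / 2 - a)) * H) ^ p *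
                volume.real (superlevel u k b)) := by
            rw [div_mul_eq_mul_div, le_div_iff₀ hC₀]
            linarith
          rw [hE]
          calc _ ≤ Real.exp 1 * (2 / C₀ * (K * ((m * C₁ * (2 * L) + 1) ^ p * (H / (b - a)) ^ p) *
                volume.real (superlevel u k b))) := by
                refine mul_le_mul_of_nonneg_left (e2.trans ?_) (Real.exp_pos 1).le
                gcongr
            _ = _ := by ring
  -- The smooth positive part has a good derivative only above `k + 1 / (n + 1)`; the bounds are
  -- uniform in `n`, and these sets increase to the whole superlevel set.
  have hU : superlevel u k a = ⋃ n : ℕ, superlevel u (k + 1 / ((n : ℝ) + 1)) a := by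
    ext x
    simp only [superlevel, Set.mem_iUnion, Set.mem_inter_iff, Set.mem_ofPred_eq, exists_and_right]
    refine and_congr_left fun _ => ⟨fun hx => ?_, fun ⟨n, hn⟩ => ?_⟩
    · obtain ⟨n, hn⟩ := exists_nat_one_div_lt (sub_pos.2 hx)
      exact ⟨n, by linarith⟩
    · have : (0 : ℝ) < 1 / (n + 1) := by positivity
      linarith
  rw [hU, setLIntegral_iUnion_of_directed]
  · exact iSup_le hstep
  · refine Monotone.directed_le fun i j hij x hx => ⟨?_, hx.2⟩
    have h1 : k + 1 / ((i : ℝ) + 1) < u x := hx.1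
    refine lt_of_le_of_lt ?_ h1
    gcongr

end CaccioppoliInequality

/-! ### The De Giorgi recursion for superlevel sets -/

section DeGiorgi

open Filter Topology
open scoped ENNReal NNReal

variable {N : ℕ}

theorem superlevel_subset {u : RN N → ℝ} {k l r s : ℝ} (hkl : k ≤ l) (hrs : r ≤ s) :
    superlevel u l r ⊆ superlevel u k s := fun _ hx =>
  ⟨lt_of_le_of_lt hkl hx.1, Metric.ball_subset_ball hrs hx.2⟩

theorem real_superlevel_mono {u : RN N → ℝ} {k l r s : ℝ} (hkl : k ≤ l) (hrs : r ≤ s) :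
    volume.real (superlevel u l r) ≤ volume.real (superlevel u k s) :=
  measureReal_mono (superlevel_subset hkl hrs) (volume_superlevel_ne_top u k s)

theorem superlevel_subset_closedBall {u : RN N → ℝ} {k r R₀ : ℝ} (hr : r ≤ R₀) :
    superlevel u k r ⊆ Metric.closedBall 0 R₀ :=
  Set.inter_subset_right.trans
    ((Metric.ball_subset_ball hr).trans Metric.ball_subset_closedBall)

/-- Hölder's inequality applied to the Caccioppoli bound. The set `E` is free because it will be a
full superlevel set in the recursion and a layer between two levels in the isoperimetric inequality,
where the power of its measure is the gain. -/
theorem exists_lintegral_gradient_le (N : ℕ) {p C₀ C₁ : ℝ} (hp : 1 < p) (hC₀ : 0 < C₀)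
    (hC₁ : 0 ≤ C₁) : ∃ C : ℝ, 0 < C ∧ ∀ (R₀ : ℝ) (u : RN N → ℝ) (G V : RN N → RN N),
      IsLocalSolution p C₀ C₁ R₀ u G V → ∀ a b k H : ℝ, 0 < a → a < b → b ≤ R₀ → 0 ≤ H →
      (∀ᵐ x ∂volume.restrict (Metric.ball (0 : RN N) b), u x ≤ k + H) →
      ∀ E ⊆ superlevel u k a, ∫⁻ x in E, ‖G x‖ₑ ≤
        ENNReal.ofReal (C * (H / (b - a)) * volume.real (superlevel u k b) ^ (1 / p) *
          volume.real E ^ (1 - 1 / p)) := by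
  obtain ⟨C, hC, hcac⟩ := exists_caccioppoli_const N hp hC₀ hC₁
  have hp0 : 0 < p := by linarith
  refine ⟨C ^ (1 / p), by positivity, fun R₀ u G V h a b k H ha hab hb hH hu E hE => ?_⟩
  have hba : 0 < b - a := by linarith
  have hES := hE.trans (superlevel_subset_closedBall (R₀ := R₀) (by linarith))
  have hEfin : volume E ≠ ⊤ := measure_ne_top_of_subset hE (volume_superlevel_ne_top u k a)
  have hGm : AEMeasurable (fun x => ‖G x‖ₑ) (volume.restrict E) :=
    (h.memLp_gradient.1.mono_measure (Measure.restrict_mono hES le_rfl)).enorm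
  have hpp := Real.HolderConjugate.conjExponent hp
  have hhol := ENNReal.lintegral_mul_le_Lp_mul_Lq (volume.restrict E) hpp hGm
    (aemeasurable_const (b := (1 : ℝ≥0∞)))
  have hconj : 1 / p.conjExponent = 1 - 1 / p := by
    have := hpp.inv_add_inv_eq_one
    rw [one_div, one_div]
    linarith
  simp only [Pi.mul_apply, mul_one, ENNReal.one_rpow, lintegral_one, Measure.restrict_apply_univ,
    hconj] at hhol
  have h1 : (∫⁻ x in E, ‖G x‖ₑ ^ p) ^ (1 / p) ≤ ENNReal.ofReal (C ^ (1 / p) * (H / (b - a)) *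
      volume.real (superlevel u k b) ^ (1 / p)) := by
    have h2 := (lintegral_mono_set hE).trans (hcac R₀ u G V h a b k H ha hab hb hH hu)
    refine (ENNReal.rpow_le_rpow h2 (by positivity)).trans (le_of_eq ?_)
    rw [ENNReal.ofReal_rpow_of_nonneg (by positivity) (by positivity),
      Real.mul_rpow (by positivity) (by positivity), Real.mul_rpow (by positivity) (by positivity),
      ← Real.rpow_mul (by positivity), mul_one_div_cancel hp0.ne', Real.rpow_one]
  have h3 : volume E ^ (1 - 1 / p) = ENNReal.ofReal (volume.real E ^ (1 - 1 / p)) := by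
    have : 0 ≤ 1 - 1 / p := by
      rw [sub_nonneg, div_le_one hp0]; exact hp.le
    rw [← ENNReal.ofReal_rpow_of_nonneg measureReal_nonneg this, ofReal_measureReal hEfin]
  rw [ENNReal.ofReal_mul (by positivity), ← h3]
  exact hhol.trans (by gcongr)

/-- One step of the De Giorgi iteration. -/
theorem exists_superlevel_step {p C₀ C₁ q : ℝ} (hp : 1 < p) (hC₀ : 0 < C₀)
    (hC₁ : 0 ≤ C₁) (hq : (N : ℝ).HolderConjugate q) :
    ∃ C : ℝ, 0 < C ∧ ∀ (R₀ : ℝ) (u : RN N → ℝ) (G V : RN N → RN N),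
      IsLocalSolution p C₀ C₁ R₀ u G V → ∀ a b k d H : ℝ, 0 < a → a < b → b ≤ R₀ → 0 < d → d ≤ H →
      (∀ᵐ x ∂volume.restrict (Metric.ball (0 : RN N) b), u x ≤ k + H) →
      volume.real (superlevel u (k + d) a) ≤
        C * (H / d / (b - a) * volume.real (superlevel u k b)) ^ q := by
  obtain ⟨C, hC, hgrad⟩ := exists_lintegral_gradient_le N hp hC₀ hC₁
  obtain ⟨L₁, hL₁, hcut⟩ := exists_cutoff N
  obtain ⟨L₂, hL₂, hstep⟩ := exists_smooth_step
  set c := lintegralPowLePowLIntegralFDerivConst (volume : Measure (RN N)) q with hc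
  have hp0 : 0 < p := by linarith
  have hq0 : 0 < q := hq.symm.pos
  refine ⟨(c + 1) * (3 * L₁ + L₂ * C * 3) ^ q, by positivity,
    fun R₀ u G V h a b k d H ha hab hb hd hdH hu => ?_⟩
  have hba : 0 < b - a := by linarith
  have hH : 0 < H := hd.trans_le hdH
  -- Three equal gaps: the cutoff decays between `a` and `c₁`, its support lies strictly inside the
  -- ball of radius `c₂`, and the gradient bound uses the gap from `c₂` to `b`. This is the source
  -- of the factors 3.
  set c₁ := a + (b - a) / 3 with hc₁
  set c₂ := a + 2 * (b - a) / 3 with hc₂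
  obtain ⟨η, hη, hη01, hηa, hηs, hηg⟩ := hcut a c₁ ha (by linarith)
  obtain ⟨T, hT, hT01, hTk, hT1, hTd, hTdk, -⟩ := hstep k d hd
  obtain ⟨f, M, hf, hM⟩ := h.approx
  set S := Metric.closedBall (0 : RN N) R₀ with hSdef
  have hS : IsCompact S := isCompact_closedBall 0 R₀
  have hmc := hf.mul_comp hp hS hM h.memLp_gradient hη hT
  have hW := hf.memLp_mul_comp hS hM h.memLp_gradient hη hT
  set W : RN N → RN N := fun x => T (u x) • gradient η x + (η x * deriv T (u x)) • G x with hWdef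
  have hsob := hmc.sobolev hp hq hS hW.1 fun n => (tsupport_mul_subset_left (f := η)).trans
    (hηs.trans (Metric.closedBall_subset_closedBall (by linarith)))
  set A := superlevel u k b with hA
  set E := superlevel u k c₂ with hE
  have hAm : MeasurableSet A := measurableSet_superlevel h.measurable k b
  have hEm : MeasurableSet E := measurableSet_superlevel h.measurable k c₂
  have hEA : E ⊆ A := superlevel_subset le_rfl (by linarith)
  have hAfin : volume A ≠ ⊤ := volume_superlevel_ne_top u k b
  have hWle : ∀ x, ‖W x‖ₑ ≤ A.indicator (fun _ => ENNReal.ofReal (L₁ / (c₁ - a))) x +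
      E.indicator (fun x => ENNReal.ofReal (L₂ / d) * ‖G x‖ₑ) x := by
    intro x
    by_cases hxE : x ∈ E
    · rw [Set.indicator_of_mem hxE, Set.indicator_of_mem (hEA hxE)]
      refine (enorm_add_le _ _).trans ?_
      rw [enorm_smul, enorm_smul]
      gcongr
      · rw [← ofReal_norm, ← ofReal_norm, ← ENNReal.ofReal_mul (norm_nonneg _)]
        refine ENNReal.ofReal_le_ofReal ?_
        rw [Real.norm_eq_abs, abs_of_nonneg (hT01 _).1]
        exact (mul_le_mul (hT01 _).2 (hηg x) (norm_nonneg _) zero_le_one).trans (one_mul _).le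
      · rw [← ofReal_norm]
        refine ENNReal.ofReal_le_ofReal ?_
        rw [norm_mul, Real.norm_eq_abs, Real.norm_eq_abs, abs_of_nonneg (hη01 x).1]
        exact (mul_le_mul (hη01 x).2 (hTd _) (abs_nonneg _) zero_le_one).trans (one_mul _).le
    · have hW0 : W x = 0 := by
        by_cases hku : u x ≤ k
        · simp [hWdef, hTk _ hku, hTdk _ hku]
        · have hxb : x ∉ tsupport η := fun hx => hxE ⟨not_le.1 hku,
            Metric.closedBall_subset_ball (by linarith) (hηs hx)⟩
          rw [hWdef]
          simp only
          rw [gradient_eq_zero_of_notMem_tsupport hxb, image_eq_zero_of_notMem_tsupport hxb]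
          simp
      rw [hW0, enorm_zero]
      exact zero_le
  have hEA' : volume.real E ≤ volume.real A := measureReal_mono hEA hAfin
  have hintW : ∫⁻ x in S, ‖W x‖ₑ ≤ ENNReal.ofReal
      ((3 * L₁ + L₂ * C * 3) * (H / d / (b - a) * volume.real A)) := by
    have hg := hgrad R₀ u G V h c₂ b k H (by linarith) (by linarith) hb hH.le hu E subset_rfl
    calc ∫⁻ x in S, ‖W x‖ₑ ≤ ∫⁻ x in S, (A.indicator (fun _ => ENNReal.ofReal (L₁ / (c₁ - a))) x +
          E.indicator (fun x => ENNReal.ofReal (L₂ / d) * ‖G x‖ₑ) x) := lintegral_mono hWle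
      _ ≤ ∫⁻ x, (A.indicator (fun _ => ENNReal.ofReal (L₁ / (c₁ - a))) x +
          E.indicator (fun x => ENNReal.ofReal (L₂ / d) * ‖G x‖ₑ) x) :=
          setLIntegral_le_lintegral _ _
      _ = ENNReal.ofReal (L₁ / (c₁ - a)) * volume A +
          ENNReal.ofReal (L₂ / d) * ∫⁻ x in E, ‖G x‖ₑ := by
          rw [lintegral_add_left (measurable_const.indicator hAm), lintegral_indicator hAm,
            lintegral_indicator hEm, setLIntegral_const,
            lintegral_const_mul' _ _ ENNReal.ofReal_ne_top]
      _ ≤ ENNReal.ofReal (L₁ / (c₁ - a)) * ENNReal.ofReal (volume.real A) +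
          ENNReal.ofReal (L₂ / d) * ENNReal.ofReal (C * (H / (b - c₂)) * volume.real A ^ (1 / p) *
            volume.real E ^ (1 - 1 / p)) := by
          rw [ofReal_measureReal hAfin]
          gcongr
      _ = ENNReal.ofReal (L₁ / (c₁ - a) * volume.real A + L₂ / d * (C * (H / (b - c₂)) *
            volume.real A ^ (1 / p) * volume.real E ^ (1 - 1 / p))) := by
          have e1 : 0 < c₁ - a := by linarith
          have e2 : 0 < b - c₂ := by linarith
          rw [← ENNReal.ofReal_mul (by positivity), ← ENNReal.ofReal_mul (by positivity),
            ← ENNReal.ofReal_add (by positivity) (by positivity)]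
      _ ≤ _ := by
          refine ENNReal.ofReal_le_ofReal ?_
          have hpow : volume.real A ^ (1 / p) * volume.real E ^ (1 - 1 / p) ≤ volume.real A := by
            have h0 : 0 ≤ 1 - 1 / p := by
              rw [sub_nonneg, div_le_one hp0]; exact hp.le
            calc _ ≤ volume.real A ^ (1 / p) * volume.real A ^ (1 - 1 / p) := by gcongr
              _ = volume.real A := by
                rw [← Real.rpow_add_of_nonneg measureReal_nonneg (by positivity) h0]; simp
          have e1 : c₁ - a = (b - a) / 3 := by rw [hc₁]; ring
          have e2 : b - c₂ = (b - a) / 3 := by rw [hc₂]; ring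
          -- Here `d ≤ H` enters: the cutoff term lacks the factor `H / d`, and inserting it merges
          -- the two terms.
          have hHd : 1 ≤ H / d := by rw [le_div_iff₀ hd]; linarith
          rw [e1, e2, mul_assoc _ (_ ^ _) (_ ^ _)]
          calc _ ≤ L₁ / ((b - a) / 3) * (H / d * volume.real A) +
                L₂ / d * (C * (H / ((b - a) / 3)) * volume.real A) := by
                gcongr
                exact le_mul_of_one_le_left measureReal_nonneg hHd
            _ = _ := by field_simp
  have hX : 0 ≤ (3 * L₁ + L₂ * C * 3) * (H / d / (b - a) * volume.real A) := by positivity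
  -- Chebyshev: `η T(u)` equals 1 on this set.
  have hB : volume (superlevel u (k + d) a) ≤ ∫⁻ x in S, ‖η x * T (u x)‖ₑ ^ q := by
    have hBm := measurableSet_superlevel h.measurable (k + d) a
    calc volume (superlevel u (k + d) a) = ∫⁻ x in superlevel u (k + d) a, 1 := by simp
      _ ≤ ∫⁻ x in superlevel u (k + d) a, ‖η x * T (u x)‖ₑ ^ q := by
          refine setLIntegral_mono' hBm fun x hx => ?_
          rw [hηa x (Metric.ball_subset_closedBall hx.2), hT1 _ (le_of_lt hx.1)]
          simp
      _ ≤ _ := lintegral_mono_set (superlevel_subset_closedBall (by linarith))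
  have hfinal : volume (superlevel u (k + d) a) ≤ ENNReal.ofReal ((c + 1) *
      ((3 * L₁ + L₂ * C * 3) * (H / d / (b - a) * volume.real A)) ^ q) := by
    refine (hB.trans hsob).trans ?_
    rw [ENNReal.ofReal_mul (by positivity), ← ENNReal.ofReal_rpow_of_nonneg hX hq0.le]
    gcongr
    rw [← ENNReal.ofReal_coe_nnreal]
    exact ENNReal.ofReal_le_ofReal (by linarith)
  have := ENNReal.toReal_le_of_le_ofReal (by positivity) hfinal
  rwa [Real.mul_rpow (by positivity) (by positivity), ← mul_assoc] at this

end DeGiorgi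

/-! ### Isoperimetric inequality and numerical recursions -/

section Shrinking

open Filter Topology
open scoped ENNReal NNReal

variable {N : ℕ}

theorem real_volume_ball_eq [NeZero N] {r : ℝ} (hr : 0 ≤ r) :
    volume.real (Metric.ball (0 : RN N) r) =
      r ^ N * volume.real (Metric.ball (0 : RN N) 1) := by
  rw [measureReal_def, Measure.addHaar_ball _ _ hr, finrank_euclideanSpace_fin, ENNReal.toReal_mul,
    ENNReal.toReal_ofReal (by positivity), measureReal_def]

/-- De Giorgi's isoperimetric inequality for solutions. -/
theorem exists_isoperimetric_step [NeZero N] {p C₀ C₁ : ℝ} (hp : 1 < p) (hC₀ : 0 < C₀)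
    (hC₁ : 0 ≤ C₁) :
    ∃ C : ℝ, 0 < C ∧ ∀ (R₀ : ℝ) (u : RN N → ℝ) (G V : RN N → RN N),
      IsLocalSolution p C₀ C₁ R₀ u G V → ∀ s b k d H : ℝ, 0 < s → s < b → b ≤ R₀ → 0 < d → 0 ≤ H →
      (∀ᵐ x ∂volume.restrict (Metric.ball (0 : RN N) b), u x ≤ k + H) →
      volume.real (superlevel u (k + d) s) *
          volume.real (Metric.ball (0 : RN N) s \ superlevel u k s) ≤
        C * s ^ (N + 1) * (H / d / (b - s)) * volume.real (superlevel u k b) ^ (1 / p) *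
          (volume.real (superlevel u k s) - volume.real (superlevel u (k + d) s)) ^ (1 - 1 / p) := by
  obtain ⟨C, hC, hgrad⟩ := exists_lintegral_gradient_le N hp hC₀ hC₁
  obtain ⟨L, hL, hstep⟩ := exists_smooth_step
  set κ := volume.real (Metric.ball (0 : RN N) 1) with hκ
  refine ⟨2 * 2 ^ N * (κ + 1) * L * C, by positivity,
    fun R₀ u G V h s b k d H hs hsb hb hd hH hu => ?_⟩
  have hbs : 0 < b - s := by linarith
  obtain ⟨T, hT, hT01, hTk, hT1, hTd, hTdk, hTdl⟩ := hstep k d hd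
  obtain ⟨f, M, hf, hM⟩ := h.approx
  set S := Metric.closedBall (0 : RN N) R₀ with hSdef
  have hS : IsCompact S := isCompact_closedBall 0 R₀
  set B := Metric.ball (0 : RN N) s with hBdef
  have hBS : B ⊆ S := (Metric.ball_subset_ball (by linarith)).trans Metric.ball_subset_closedBall
  have hη : ContDiff ℝ ∞ fun _ : RN N => (1 : ℝ) := contDiff_const
  have hmc := hf.mul_comp hp hS hM h.memLp_gradient hη hT
  have hW := hf.memLp_mul_comp hS hM h.memLp_gradient hη hT
  set W : RN N → RN N := fun x => T (u x) • gradient (fun _ : RN N => (1 : ℝ)) x +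
    (1 * deriv T (u x)) • G x with hWdef
  have hdist : ∀ x ∈ B, ∀ y ∈ B, ‖x - y‖ ≤ 2 * s := by
    intro x hx y hy
    rw [hBdef, mem_ball_zero_iff] at hx hy
    exact (norm_sub_le x y).trans (by linarith)
  have hpoi := (hmc.mono hBS).poincare hp (convex_ball 0 s) measurableSet_ball
    measure_ball_lt_top.ne hdist (hW.1.mono_measure (Measure.restrict_mono hBS le_rfl))
  have hm1 := measurableSet_superlevel h.measurable k s
  have hm2 := measurableSet_superlevel h.measurable (k + d) s
  have hsub : superlevel u (k + d) s ⊆ superlevel u k s := superlevel_subset (by linarith) le_rfl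
  set E := superlevel u k s \ superlevel u (k + d) s with hE
  have hEm : MeasurableSet E := hm1.diff hm2
  have hEr : volume.real E = volume.real (superlevel u k s) -
      volume.real (superlevel u (k + d) s) :=
    measureReal_sdiff hsub hm2 (volume_superlevel_ne_top u _ _)
  -- With the trivial cutoff 1 the gradient of `T(u)` lives only on the layer `k < u ≤ k + d`, since
  -- the derivative of `T` vanishes on both sides.
  have hWle : ∀ x ∈ B, ‖W x‖ₑ ≤ E.indicator (fun x => ENNReal.ofReal (L / d) * ‖G x‖ₑ) x := by
    intro x hx
    have hWx : W x = deriv T (u x) • G x := by simp [hWdef, gradient]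
    by_cases hxE : x ∈ E
    · rw [Set.indicator_of_mem hxE, hWx, enorm_smul]
      gcongr
      rw [← ofReal_norm]
      exact ENNReal.ofReal_le_ofReal (hTd _)
    · have h0 : deriv T (u x) = 0 := by
        by_cases hku : u x ≤ k
        · exact hTdk _ hku
        · refine hTdl _ ?_
          by_contra hlt
          exact hxE ⟨⟨not_le.1 hku, hx⟩, fun hx2 => hlt (le_of_lt hx2.1)⟩
      rw [hWx, h0, zero_smul, enorm_zero]
      exact zero_le
  have hintW : ∫⁻ x in B, ‖W x‖ₑ ≤ ENNReal.ofReal (L / d * (C * (H / (b - s)) *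
      volume.real (superlevel u k b) ^ (1 / p) * volume.real E ^ (1 - 1 / p))) := by
    have hg := hgrad R₀ u G V h s b k H hs hsb hb hH hu E Set.sdiff_subset
    calc ∫⁻ x in B, ‖W x‖ₑ ≤ ∫⁻ x in B, E.indicator (fun x => ENNReal.ofReal (L / d) * ‖G x‖ₑ) x :=
          setLIntegral_mono' measurableSet_ball hWle
      _ ≤ ∫⁻ x, E.indicator (fun x => ENNReal.ofReal (L / d) * ‖G x‖ₑ) x :=
          setLIntegral_le_lintegral _ _
      _ = ENNReal.ofReal (L / d) * ∫⁻ x in E, ‖G x‖ₑ := by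
          rw [lintegral_indicator hEm, lintegral_const_mul' _ _ ENNReal.ofReal_ne_top]
      _ ≤ _ := by
          rw [ENNReal.ofReal_mul (by positivity)]
          gcongr
  -- `T(u)` is 1 on the first set and 0 on the second, so the difference is 1 on their product.
  have hlow : volume (superlevel u (k + d) s) * volume (B \ superlevel u k s) ≤
      ∫⁻ x in B, ∫⁻ y in B, ‖1 * T (u x) - 1 * T (u y)‖ₑ := by
    have hZm : MeasurableSet (B \ superlevel u k s) := measurableSet_ball.diff hm1
    calc volume (superlevel u (k + d) s) * volume (B \ superlevel u k s)
        = ∫⁻ x in superlevel u (k + d) s, ∫⁻ y in B \ superlevel u k s, 1 := by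
          simp [mul_comm]
      _ ≤ ∫⁻ x in superlevel u (k + d) s, ∫⁻ y in B, ‖1 * T (u x) - 1 * T (u y)‖ₑ := by
          refine setLIntegral_mono' hm2 fun x hx => le_trans ?_
            (lintegral_mono_set (s := B \ superlevel u k s) Set.sdiff_subset)
          refine setLIntegral_mono' hZm fun y hy => ?_
          have hy1 : u y ≤ k := not_lt.1 fun hlt => hy.2 ⟨hlt, hy.1⟩
          rw [hT1 _ (le_of_lt hx.1), hTk _ hy1]
          simp
      _ ≤ _ := lintegral_mono_set Set.inter_subset_right
  have hBv : volume B = ENNReal.ofReal (s ^ N * κ) := by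
    rw [← real_volume_ball_eq hs.le, ofReal_measureReal measure_ball_lt_top.ne]
  have hfin := hlow.trans (hpoi.trans (mul_le_mul_right hintW _))
  rw [hBv, show (2 : ℝ≥0∞) ^ N = ENNReal.ofReal (2 ^ N) by
      rw [ENNReal.ofReal_pow (by norm_num)]; simp,
    ← ENNReal.ofReal_mul (by positivity), ← ENNReal.ofReal_mul (by positivity),
    ← ENNReal.ofReal_mul (by positivity)] at hfin
  have hreal := ENNReal.toReal_le_of_le_ofReal (by positivity) hfin
  rw [ENNReal.toReal_mul] at hreal
  rw [← hEr]
  refine hreal.trans ?_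
  have hX : 0 ≤ s ^ (N + 1) * (H / d / (b - s)) * volume.real (superlevel u k b) ^ (1 / p) *
      volume.real E ^ (1 - 1 / p) := by positivity
  calc _ = 2 * 2 ^ N * κ * L * C * (s ^ (N + 1) * (H / d / (b - s)) *
        volume.real (superlevel u k b) ^ (1 / p) * volume.real E ^ (1 - 1 / p)) := by
        field_simp
        ring
    _ ≤ 2 * 2 ^ N * (κ + 1) * L * C * (s ^ (N + 1) * (H / d / (b - s)) *
        volume.real (superlevel u k b) ^ (1 / p) * volume.real E ^ (1 - 1 / p)) := by
        gcongr
        linarith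
    _ = _ := by ring

/-- Fast geometric convergence. -/
theorem tendsto_zero_of_fast_geometric {D b q : ℝ} (hD : 0 < D) (hb : 1 < b) (hq : 1 < q) :
    ∃ ν : ℝ, 0 < ν ∧ ∀ Z : ℕ → ℝ, (∀ n, 0 ≤ Z n) → (∀ n, Z (n + 1) ≤ D * b ^ n * Z n ^ q) →
      Z 0 ≤ ν → Tendsto Z atTop (𝓝 0) := by
  have hβ : 0 < q - 1 := by linarith
  have hb0 : 0 < b := by linarith
  -- The ansatz `Z n ≤ ν ρ ^ n` is preserved when `ρ ^ (q - 1)` cancels `b` and `D ν ^ (q - 1) = ρ`;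
  -- these two equations determine `ρ` and `ν`.
  set ρ := b ^ (-(1 / (q - 1))) with hρ
  have hρ0 : 0 < ρ := Real.rpow_pos_of_pos hb0 _
  have hρ1 : ρ < 1 := Real.rpow_lt_one_of_one_lt_of_neg hb (by rw [neg_neg_iff_pos]; positivity)
  have hρb : ρ ^ (q - 1) = b⁻¹ := by
    rw [hρ, ← Real.rpow_mul hb0.le, neg_mul, one_div_mul_cancel hβ.ne', Real.rpow_neg_one]
  set ν := (ρ / D) ^ (1 / (q - 1)) with hν
  have hν0 : 0 < ν := by positivity
  have hνD : D * ν ^ (q - 1) = ρ := by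
    rw [hν, ← Real.rpow_mul (by positivity), one_div_mul_cancel hβ.ne', Real.rpow_one]
    field_simp
  refine ⟨ν, hν0, fun Z hZ hrec h0 => ?_⟩
  have key : ∀ n, Z n ≤ ν * ρ ^ n := by
    intro n
    induction n with
    | zero => simpa using h0
    | succ n ih =>
      have e1 : (ν * ρ ^ n) ^ q = ν * ρ ^ n * (ν ^ (q - 1) * (b⁻¹) ^ n) := by
        have hx : 0 < ν * ρ ^ n := by positivity
        have : q = 1 + (q - 1) := by ring
        rw [this, Real.rpow_add hx, Real.rpow_one, add_sub_cancel_left,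
          Real.mul_rpow hν0.le (by positivity), ← hρb, ← Real.rpow_natCast, ← Real.rpow_natCast,
          ← Real.rpow_mul hρ0.le, ← Real.rpow_mul hρ0.le, mul_comm (n : ℝ)]
      calc Z (n + 1) ≤ D * b ^ n * Z n ^ q := hrec n
        _ ≤ D * b ^ n * (ν * ρ ^ n) ^ q := by
            gcongr
            exact hZ n
        _ = ν * ρ ^ n * (D * ν ^ (q - 1)) * (b ^ n * b⁻¹ ^ n) := by rw [e1]; ring
        _ = ν * ρ ^ (n + 1) := by
            rw [hνD, ← mul_pow, mul_inv_cancel₀ hb0.ne', one_pow, pow_succ]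
            ring
  refine squeeze_zero hZ key ?_
  simpa using (tendsto_pow_atTop_nhds_zero_of_lt_one hρ0.le hρ1).const_mul ν

/-- A decreasing sequence with `z (j+1) ^ r ≤ C (z j - z (j+1))` gets small, uniformly. -/
theorem exists_index_le_of_rpow_le_sub {C Z₀ r ν : ℝ} (hr : 0 < r) (hν : 0 < ν)
    (hC : 0 < C) :
    ∃ J : ℕ, ∀ z : ℕ → ℝ, (∀ n, 0 ≤ z n) → z 0 ≤ Z₀ →
      (∀ n, z (n + 1) ^ r ≤ C * (z n - z (n + 1))) → z J ≤ ν := by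
  obtain ⟨J, hJ⟩ := exists_nat_gt (C * Z₀ / ν ^ r)
  refine ⟨J, fun z hz h0 hrec => ?_⟩
  by_contra hlt
  rw [not_le] at hlt
  have hνr : 0 < ν ^ r := Real.rpow_pos_of_pos hν r
  have hanti : Antitone z := antitone_nat_of_succ_le fun n => by
    have h1 : 0 ≤ z (n + 1) ^ r := Real.rpow_nonneg (hz _) r
    exact sub_nonneg.1 (nonneg_of_mul_nonneg_right (h1.trans (hrec n)) hC)
  -- If `z J > ν`, each of the first `J` steps costs at least `ν ^ r / C`, and the costs telescope
  -- to at most `z 0 ≤ Z₀`.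
  have hsum : ∀ n ≤ J, n * ν ^ r ≤ C * (z 0 - z n) := by
    intro n
    induction n with
    | zero => simp
    | succ n ih =>
      intro hn
      have h1 := ih (by omega)
      have h2 : ν ^ r ≤ z (n + 1) ^ r :=
        Real.rpow_le_rpow hν.le (hlt.le.trans (hanti hn)) hr.le
      have h3 := h2.trans (hrec n)
      push_cast
      linarith
  have h4 := hsum J le_rfl
  rw [div_lt_iff₀ hνr] at hJ
  nlinarith [hz J]

end Shrinking

/-! ### Reduction of the oscillation -/

section OscillationDecay

open Filter Topology
open scoped ENNReal NNReal

variable {N : ℕ}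

theorem superlevel_subset_ball {u : RN N → ℝ} {k r : ℝ} : superlevel u k r ⊆ Metric.ball 0 r :=
  Set.inter_subset_right

/-- If `u ≤ k + H` and `u > k` only on a small part of a ball, then `u ≤ k + H / 2` on the ball
of half the radius. -/
theorem exists_sup_const {p C₀ C₁ q : ℝ} (hp : 1 < p) (hC₀ : 0 < C₀) (hC₁ : 0 ≤ C₁)
    (hq : (N : ℝ).HolderConjugate q) :
    ∃ ν : ℝ, 0 < ν ∧ ∀ (R₀ : ℝ) (u : RN N → ℝ) (G V : RN N → RN N),
      IsLocalSolution p C₀ C₁ R₀ u G V → ∀ r k H : ℝ, 0 < r → r ≤ R₀ → 0 < H →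
      (∀ᵐ x ∂volume.restrict (Metric.ball (0 : RN N) r), u x ≤ k + H) →
      volume.real (superlevel u k r) ≤ ν * r ^ N →
      ∀ᵐ x ∂volume.restrict (Metric.ball (0 : RN N) (r / 2)), u x ≤ k + H / 2 := by
  obtain ⟨C, hC, hstep⟩ := exists_superlevel_step hp hC₀ hC₁ hq
  have hq1 : 1 < q := hq.symm.lt
  -- Level and radius gaps at step `n` are `H 2 ^ (-n) / 4` and `r 2 ^ (-n) / 4`, so the factor in
  -- the recursion is `16 * 4 ^ n / r`, raised to the power `q`.
  obtain ⟨ν, hν, hgeo⟩ := tendsto_zero_of_fast_geometric (D := C * 16 ^ q) (b := 4 ^ q)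
    (by positivity) (Real.one_lt_rpow (by norm_num) (by linarith)) hq1
  refine ⟨ν, hν, fun R₀ u G V h r k H hr hrR hH hu h0 => ?_⟩
  set rr : ℕ → ℝ := fun n => r / 2 * (1 + (1 / 2) ^ n) with hrr
  set kk : ℕ → ℝ := fun n => k + H / 2 * (1 - (1 / 2) ^ n) with hkk
  have hrN : 0 < r ^ N := by positivity
  have hhalf : ∀ n : ℕ, (0 : ℝ) < (1 / 2) ^ n ∧ ((1 : ℝ) / 2) ^ n ≤ 1 := fun n =>
    ⟨by positivity, pow_le_one₀ (by norm_num) (by norm_num)⟩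
  have hrle : ∀ n, rr n ≤ r := fun n => by
    have := (hhalf n).2
    simp only [hrr]
    nlinarith
  -- Scale invariance: `(N - 1) q = N`, so the recursion for the measures divided by `r ^ N` does
  -- not involve `r`.
  have hrpow : (r ^ N / r) ^ q = r ^ N := by
    have e : r ^ N / r = r ^ ((N : ℝ) - 1) := by
      rw [Real.rpow_sub hr, Real.rpow_one, Real.rpow_natCast]
    rw [e, ← Real.rpow_mul hr.le, hq.sub_one_mul_conj, Real.rpow_natCast]
  have hZ := hgeo (fun n => volume.real (superlevel u (kk n) (rr n)) / r ^ N)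
    (fun n => by positivity) (fun n => ?_) ?_
  · have hle : ∀ n, volume.real (superlevel u (k + H / 2) (r / 2)) / r ^ N ≤
        volume.real (superlevel u (kk n) (rr n)) / r ^ N := fun n => by
      have := hhalf n
      refine div_le_div_of_nonneg_right (real_superlevel_mono ?_ ?_) hrN.le
      · simp only [hkk]; nlinarith
      · simp only [hrr]; nlinarith
    have hz := ge_of_tendsto' hZ hle
    have hz0 : volume.real (superlevel u (k + H / 2) (r / 2)) = 0 := by
      rw [div_le_iff₀ hrN, zero_mul] at hz
      exact le_antisymm hz measureReal_nonneg
    rw [measureReal_eq_zero_iff (volume_superlevel_ne_top u _ _)] at hz0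
    rw [ae_restrict_iff' measurableSet_ball, ae_iff]
    refine measure_mono_null (fun x hx => ?_) hz0
    simp only [Set.mem_ofPred_eq, Classical.not_imp, not_le] at hx
    exact ⟨hx.2, hx.1⟩
  · have hn := hhalf n
    have hd : 0 < H * (1 / 2) ^ n / 4 := by positivity
    have e1 : kk (n + 1) = kk n + H * (1 / 2) ^ n / 4 := by simp only [hkk]; ring
    have hab : rr n - rr (n + 1) = r * (1 / 2) ^ n / 4 := by simp only [hrr]; ring
    have hs := hstep R₀ u G V h (rr (n + 1)) (rr n) (kk n) (H * (1 / 2) ^ n / 4) H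
      (by simp only [hrr]; positivity) (sub_pos.1 (by rw [hab]; positivity))
      ((hrle n).trans hrR) hd (by nlinarith) (by
        have := ae_restrict_of_ae_restrict_of_subset (Metric.ball_subset_ball (hrle n)) hu
        filter_upwards [this] with x hx
        have : k ≤ kk n := by simp only [hkk]; nlinarith
        linarith)
    rw [← e1, hab] at hs
    set Y := volume.real (superlevel u (kk n) (rr n))
    have hY : 0 ≤ Y := measureReal_nonneg
    have h2 : ((1 : ℝ) / 2) ^ n * (1 / 2) ^ n * 4 ^ n = 1 := by
      rw [← mul_pow, ← mul_pow]; norm_num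
    have e2 : H / (H * (1 / 2) ^ n / 4) / (r * (1 / 2) ^ n / 4) * Y =
        16 * 4 ^ n * (r ^ N / r) * (Y / r ^ N) := by
      have h3 := hn.1.ne'
      have h4 : (4 : ℝ) ^ n = 1 / ((1 / 2) ^ n * (1 / 2) ^ n) := by
        rw [eq_div_iff (by positivity)]
        linarith
      rw [h4]
      generalize ((1 : ℝ) / 2) ^ n = t at h3
      field_simp
      ring
    rw [e2, Real.mul_rpow (by positivity) (by positivity), Real.mul_rpow (by positivity)
      (by positivity), Real.mul_rpow (by positivity) (by positivity), hrpow] at hs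
    rw [div_le_iff₀ hrN]
    refine hs.trans (le_of_eq ?_)
    rw [← Real.rpow_natCast 4 n, ← Real.rpow_natCast (4 ^ q) n, ← Real.rpow_mul (by norm_num),
      ← Real.rpow_mul (by norm_num), mul_comm (n : ℝ) q]
    ring
  · simp only [hrr, hkk, pow_zero, sub_self, mul_zero, add_zero]
    rw [div_le_iff₀ hrN, show r / 2 * (1 + 1) = r by ring]
    exact h0

/-- Superlevel sets shrink at high levels if `u` is below its mean level on half of the ball. -/
theorem exists_shrink_index [NeZero N] {p C₀ C₁ ν : ℝ} (hp : 1 < p) (hC₀ : 0 < C₀) (hC₁ : 0 ≤ C₁)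
    (hν : 0 < ν) :
    ∃ J : ℕ, ∀ (R₀ : ℝ) (u : RN N → ℝ) (G V : RN N → RN N),
      IsLocalSolution p C₀ C₁ R₀ u G V → ∀ s M δ : ℝ, 0 < s → 2 * s ≤ R₀ → 0 < δ →
      (∀ᵐ x ∂volume.restrict (Metric.ball (0 : RN N) (2 * s)), u x ≤ M) →
      volume.real (superlevel u (M - δ / 2) s) ≤ volume.real (Metric.ball (0 : RN N) s) / 2 →
      volume.real (superlevel u (M - δ / 2 ^ (J + 1)) s) ≤ ν * s ^ N := by
  obtain ⟨C, hC, hiso⟩ := exists_isoperimetric_step (N := N) hp hC₀ hC₁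
  have hp0 : 0 < p := by linarith
  set κ := volume.real (Metric.ball (0 : RN N) 1) with hκ
  have hκ0 : 0 < κ := ENNReal.toReal_pos (Metric.measure_ball_pos _ _ one_pos).ne'
    measure_ball_lt_top.ne
  set e := 1 - 1 / p with he
  have he0 : 0 < e := by rw [he, sub_pos, div_lt_one hp0]; exact hp
  set C' := 4 * C / κ * (2 ^ N * κ) ^ (1 / p) with hC'
  have hC'0 : 0 < C' := by positivity
  obtain ⟨J, hJ⟩ := exists_index_le_of_rpow_le_sub (C := C' ^ (1 / e)) (Z₀ := κ) (r := 1 / e)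
    (ν := ν) (by positivity) hν (by positivity)
  refine ⟨J, fun R₀ u G V h s M δ hs hsR hδ hu hhalf => ?_⟩
  have hsN : 0 < s ^ N := by positivity
  have hball : volume.real (Metric.ball (0 : RN N) s) = s ^ N * κ := real_volume_ball_eq hs.le
  set a : ℕ → ℝ := fun n => volume.real (superlevel u (M - δ / 2 ^ (n + 1)) s) with ha
  have hmono : ∀ n, a n ≤ a 0 := fun n => by
    refine real_superlevel_mono ?_ le_rfl
    rw [zero_add]
    gcongr
    · norm_num
    · omega
  have ha_ball : ∀ n, a n ≤ s ^ N * κ := fun n => by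
    rw [← hball]
    exact measureReal_mono Set.inter_subset_right measure_ball_lt_top.ne
  have key := hJ (fun n => a n / s ^ N) (fun n => by positivity)
    (by rw [div_le_iff₀ hsN, mul_comm]; exact ha_ball 0) (fun n => ?_)
  · rwa [div_le_iff₀ hsN] at key
  set k := M - δ / 2 ^ (n + 1) with hk
  -- This is the gap to the next level, and the bound `M` is `2 * d` above `k`; hence `H / d = 2` at
  -- every level and the constants do not depend on `n`.
  set d := δ / 2 ^ (n + 2) with hd
  have hd0 : 0 < d := by positivity
  have hH : δ / 2 ^ (n + 1) = 2 * d := by rw [hd]; field_simp; ring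
  have hkd : k + d = M - δ / 2 ^ (n + 1 + 1) := by
    rw [hk, hH]
    simp only [hd]
    ring
  have h1 := hiso R₀ u G V h s (2 * s) k d (2 * d) hs (by linarith) hsR hd0 (by positivity)
    (by filter_upwards [hu] with x hx; rw [hk, hH]; linarith)
  rw [hkd] at h1
  -- Levels increase with `n`, so the hypothesis on half of the ball persists.
  have hdiff : s ^ N * κ / 2 ≤ volume.real (Metric.ball (0 : RN N) s \ superlevel u k s) := by
    rw [measureReal_sdiff superlevel_subset_ball (measurableSet_superlevel h.measurable k s)
      measure_ball_lt_top.ne, hball]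
    have h2 := hmono n
    simp only [ha, zero_add, pow_one] at h2
    rw [hball] at hhalf
    linarith
  have hsuper : volume.real (superlevel u k (2 * s)) ≤ s ^ N * (2 ^ N * κ) := by
    refine (measureReal_mono Set.inter_subset_right measure_ball_lt_top.ne).trans (le_of_eq ?_)
    rw [real_volume_ball_eq (by positivity), mul_pow]
    ring
  have hdec : 0 ≤ a n - a (n + 1) := sub_nonneg.2 (real_superlevel_mono (by
    rw [← hkd]; linarith) le_rfl)
  have h3 : a (n + 1) / s ^ N ≤ C' * (a n / s ^ N - a (n + 1) / s ^ N) ^ e := by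
    have hpe : (1 : ℝ) / p + e = 1 := by rw [he]; ring
    have h4 : a (n + 1) * (s ^ N * κ / 2) ≤ C * s ^ (N + 1) * (2 * d / d / (2 * s - s)) *
        (s ^ N * (2 ^ N * κ)) ^ (1 / p) * (a n - a (n + 1)) ^ e := by
      refine le_trans (mul_le_mul_of_nonneg_left hdiff measureReal_nonneg) (h1.trans ?_)
      have : 0 < 2 * s - s := by linarith
      gcongr
    have h5 : (a n - a (n + 1)) ^ e = (s ^ N) ^ e * (a n / s ^ N - a (n + 1) / s ^ N) ^ e := by
      rw [← sub_div, ← Real.mul_rpow hsN.le (by positivity), mul_div_cancel₀ _ hsN.ne']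
    have h6 : (s ^ N) ^ (1 / p) * (s ^ N) ^ e = s ^ N := by
      rw [← Real.rpow_add hsN, hpe, Real.rpow_one]
    rw [h5, Real.mul_rpow hsN.le (by positivity)] at h4
    set D := (a n / s ^ N - a (n + 1) / s ^ N) ^ e
    have h7 : a (n + 1) * (s ^ N * κ / 2) ≤
        2 * C * s ^ N * s ^ N * ((2 ^ N * κ) ^ (1 / p) * D) := by
      refine h4.trans (le_of_eq ?_)
      have : 2 * d / d / (2 * s - s) = 2 / s := by
        rw [show 2 * s - s = s by ring]; field_simp
      rw [this]
      calc _ = C * (s ^ (N + 1) * (2 / s)) * ((s ^ N) ^ (1 / p) * (s ^ N) ^ e) *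
            ((2 ^ N * κ) ^ (1 / p) * D) := by ring
        _ = _ := by rw [h6, pow_succ]; field_simp
    rw [div_le_iff₀ hsN]
    have h8 : 0 < s ^ N * κ / 2 := by positivity
    refine le_of_mul_le_mul_right (h7.trans (le_of_eq ?_)) h8
    rw [hC']
    field_simp
    ring
  calc (a (n + 1) / s ^ N) ^ (1 / e) ≤ (C' * (a n / s ^ N - a (n + 1) / s ^ N) ^ e) ^ (1 / e) := by
        gcongr
    _ = C' ^ (1 / e) * (a n / s ^ N - a (n + 1) / s ^ N) := by
        have : 0 ≤ a n / s ^ N - a (n + 1) / s ^ N := by rw [← sub_div]; positivity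
        rw [Real.mul_rpow hC'0.le (by positivity), ← Real.rpow_mul this,
          mul_one_div_cancel he0.ne', Real.rpow_one]

theorem exists_osc_reduction [NeZero N] {p C₀ C₁ q : ℝ} (hp : 1 < p) (hC₀ : 0 < C₀) (hC₁ : 0 ≤ C₁)
    (hq : (N : ℝ).HolderConjugate q) :
    ∃ θ : ℝ, 0 < θ ∧ θ < 1 ∧ ∀ (R₀ : ℝ) (u : RN N → ℝ) (G V : RN N → RN N),
      IsLocalSolution p C₀ C₁ R₀ u G V → ∀ r m M : ℝ, 0 < r → r ≤ R₀ → m ≤ M →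
      (∀ᵐ x ∂volume.restrict (Metric.ball (0 : RN N) r), m ≤ u x ∧ u x ≤ M) →
      ∃ m' M', m' ≤ M' ∧ M' - m' = θ * (M - m) ∧
        ∀ᵐ x ∂volume.restrict (Metric.ball (0 : RN N) (r / 4)), m' ≤ u x ∧ u x ≤ M' := by
  obtain ⟨ν, hν, hsup⟩ := exists_sup_const hp hC₀ hC₁ hq
  obtain ⟨J, hJ⟩ := exists_shrink_index (N := N) hp hC₀ hC₁ hν
  have hθ : (1 : ℝ) / 2 ^ (J + 2) < 1 := by
    rw [div_lt_one (by positivity)]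
    exact one_lt_pow₀ (by norm_num) (by omega)
  have hθ0 : (0 : ℝ) < 1 / 2 ^ (J + 2) := by positivity
  have upper : ∀ (R₀ : ℝ) (u : RN N → ℝ) (G V : RN N → RN N),
      IsLocalSolution p C₀ C₁ R₀ u G V → ∀ r M δ : ℝ, 0 < r → r ≤ R₀ → 0 < δ →
      (∀ᵐ x ∂volume.restrict (Metric.ball (0 : RN N) r), u x ≤ M) →
      volume.real (superlevel u (M - δ / 2) (r / 2)) ≤
        volume.real (Metric.ball (0 : RN N) (r / 2)) / 2 →
      ∀ᵐ x ∂volume.restrict (Metric.ball (0 : RN N) (r / 4)), u x ≤ M - 1 / 2 ^ (J + 2) * δ := by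
    intro R₀ u G V h r M δ hr hrR hδ hu hhalf
    have h1 := hJ R₀ u G V h (r / 2) M δ (by positivity) (by linarith) hδ
      (by rwa [mul_div_cancel₀ _ two_ne_zero]) hhalf
    have h2 := hsup R₀ u G V h (r / 2) (M - δ / 2 ^ (J + 1)) (δ / 2 ^ (J + 1)) (by positivity)
      (by linarith) (by positivity) (by
        have := ae_restrict_of_ae_restrict_of_subset
          (Metric.ball_subset_ball (by linarith : r / 2 ≤ r)) hu
        filter_upwards [this] with x hx
        linarith) h1
    rw [show r / 2 / 2 = r / 4 by ring] at h2
    filter_upwards [h2] with x hx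
    refine hx.trans (le_of_eq ?_)
    rw [pow_succ _ (J + 1)]
    field_simp
    ring
  -- Shrinking in the ball of radius `r / 2` reaches the level `M - δ / 2 ^ (J + 1)`; the sup bound
  -- then halves the remaining gap in the ball of radius `r / 4`.
  refine ⟨1 - 1 / 2 ^ (J + 2), by linarith, by linarith, fun R₀ u G V h r m M hr hrR hmM hu => ?_⟩
  have hsub : ∀ᵐ x ∂volume.restrict (Metric.ball (0 : RN N) (r / 4)), m ≤ u x ∧ u x ≤ M :=
    ae_restrict_of_ae_restrict_of_subset (Metric.ball_subset_ball (by linarith)) hu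
  set δ := M - m with hδ
  rcases hmM.eq_or_lt with rfl | hlt
  · exact ⟨m, m, le_rfl, by simp [hδ], hsub⟩
  have hδ0 : 0 < δ := sub_pos.2 hlt
  have hθδ : 0 ≤ (1 - 1 / 2 ^ (J + 2)) * δ := mul_nonneg (by linarith) hδ0.le
  -- `M - δ / 2` is the midpoint of `m` and `M`. If `u` exceeds it on more than half of the ball,
  -- `-u` exceeds the negative of the midpoint on less than half.
  by_cases hhalf : volume.real (superlevel u (M - δ / 2) (r / 2)) ≤
      volume.real (Metric.ball (0 : RN N) (r / 2)) / 2
  · have h1 := upper R₀ u G V h r M δ hr hrR hδ0 (hu.mono fun x hx => hx.2) hhalf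
    refine ⟨m, M - 1 / 2 ^ (J + 2) * δ, by linarith, by rw [hδ]; ring, ?_⟩
    filter_upwards [hsub, h1] with x hx1 hx2 using ⟨hx1.1, hx2⟩
  · have h1 := upper R₀ _ _ _ h.neg r (-m) δ hr hrR hδ0
      (hu.mono fun x hx => neg_le_neg hx.1) (by
        have hss : superlevel (fun x => -u x) (-m - δ / 2) (r / 2) ⊆
            Metric.ball (0 : RN N) (r / 2) \ superlevel u (M - δ / 2) (r / 2) := by
          rintro x ⟨hx1, hx2⟩
          refine ⟨hx2, fun hx3 => ?_⟩
          have h4 : -m - δ / 2 < -u x := hx1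
          have h5 : M - δ / 2 < u x := hx3.1
          linarith
        refine (measureReal_mono hss (measure_ne_top_of_subset Set.sdiff_subset
          measure_ball_lt_top.ne)).trans ?_
        rw [measureReal_sdiff superlevel_subset_ball (measurableSet_superlevel h.measurable _ _)
          measure_ball_lt_top.ne]
        linarith)
    refine ⟨m + 1 / 2 ^ (J + 2) * δ, M, by linarith, by rw [hδ]; ring, ?_⟩
    filter_upwards [hsub, h1] with x hx1 hx2 using ⟨by linarith, hx1.2⟩

end OscillationDecay

/-! ### Cubes, balls and essential oscillation -/

section Cubes

open Filter Topology

variable {N : ℕ}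

theorem isOpen_cube (r : ℝ) : IsOpen (cube N r) := by
  simp only [cube, Set.ofPred_forall]
  exact isOpen_iInter_of_finite fun i => isOpen_lt (by fun_prop) continuous_const

theorem ball_subset_cube (r : ℝ) : Metric.ball (0 : RN N) (r / 2) ⊆ cube N r := by
  intro x hx i
  rw [mem_ball_zero_iff] at hx
  exact lt_of_le_of_lt (PiLp.norm_apply_le x i) hx

theorem norm_le_of_mem_cube {r : ℝ} (hr : 0 ≤ r) {x : RN N} (hx : x ∈ cube N r) :
    ‖x‖ ≤ N * r / 2 := by
  refine (le_abs_self _).trans (abs_le_of_sq_le_sq ?_ (by positivity))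
  rw [EuclideanSpace.norm_sq_eq]
  have h1 : ∀ i ∈ Finset.univ, ‖x i‖ ^ 2 ≤ (r / 2) ^ 2 := fun i _ => by
    have := hx i
    rw [Real.norm_eq_abs]
    gcongr
  refine (Finset.sum_le_sum h1).trans ?_
  rw [Finset.sum_const, Finset.card_univ, Fintype.card_fin, nsmul_eq_mul]
  have h2 : (N : ℝ) ≤ N ^ 2 := by exact_mod_cast Nat.le_self_pow two_ne_zero N
  calc (N : ℝ) * (r / 2) ^ 2 ≤ N ^ 2 * (r / 2) ^ 2 := by gcongr
    _ = _ := by ring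

theorem cube_mono {r s : ℝ} (h : r ≤ s) : cube N r ⊆ cube N s := fun x hx i =>
  (hx i).trans_le (by linarith)

theorem volume_cube_ne_zero {r : ℝ} (hr : 0 < r) : volume (cube N r) ≠ 0 :=
  ((isOpen_cube r).measure_pos volume ⟨0, fun i => by simpa using hr⟩).ne'

theorem osc_eq_zero_of_volume_eq_zero {u : RN N → ℝ} {K : Set (RN N)} (hK : volume K = 0) :
    osc u K = 0 := by
  rw [osc, Measure.restrict_eq_zero.2 hK]
  -- For the zero measure both bounds are taken over all of `ℝ`, where `sInf` and `sSup` have the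
  -- default value 0.
  simp [essSup, essInf, limsup, liminf, limsSup, limsInf]

theorem osc_le_of_ae {u : RN N → ℝ} {K : Set (RN N)} (hK : volume K ≠ 0) {m M : ℝ}
    (h : ∀ᵐ x ∂volume.restrict K, m ≤ u x ∧ u x ≤ M) : osc u K ≤ M - m := by
  have : NeZero (volume.restrict K) := ⟨by rwa [Ne, Measure.restrict_eq_zero]⟩
  have h1 : essSup u (volume.restrict K) ≤ M := by
    refine limsup_le_of_le ?_ (h.mono fun x hx => hx.2)
    -- A real-valued limsup needs the lower bound too, to exclude default values; nonzero measure
    -- makes this meaningful.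
    exact IsBoundedUnder.isCoboundedUnder_le ⟨m, eventually_map.2 (h.mono fun x hx => hx.1)⟩
  have h2 : m ≤ essInf u (volume.restrict K) := by
    refine le_liminf_of_le ?_ (h.mono fun x hx => hx.1)
    exact IsBoundedUnder.isCoboundedUnder_ge ⟨M, eventually_map.2 (h.mono fun x hx => hx.2)⟩
  rw [osc]
  linarith

theorem ae_mem_essInf_essSup {u : RN N → ℝ} {K : Set (RN N)} {M : ℝ}
    (h : ∀ᵐ x ∂volume.restrict K, |u x| ≤ M) :
    ∀ᵐ x ∂volume.restrict K, essInf u (volume.restrict K) ≤ u x ∧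
      u x ≤ essSup u (volume.restrict K) := by
  have hle : IsBoundedUnder (· ≤ ·) (ae (volume.restrict K)) u :=
    ⟨M, eventually_map.2 (h.mono fun x hx => (abs_le.1 hx).2)⟩
  have hge : IsBoundedUnder (· ≥ ·) (ae (volume.restrict K)) u :=
    ⟨-M, eventually_map.2 (h.mono fun x hx => (abs_le.1 hx).1)⟩
  filter_upwards [ae_le_essSup hle, ae_essInf_le hge] with x h1 h2 using ⟨h2, h1⟩

theorem isCompact_closure_cube (r : ℝ) : IsCompact (closure (cube N r)) := by
  rcases lt_or_ge r 0 with hr | hr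
  · refine (Metric.isBounded_closedBall (x := (0 : RN N)) (r := N)).subset (fun x hx => ?_)
      |>.isCompact_closure
    rw [mem_closedBall_zero_iff, EuclideanSpace.norm_eq]
    rcases isEmpty_or_nonempty (Fin N) with h | ⟨⟨i⟩⟩
    · simp
    · exact absurd ((abs_nonneg _).trans_lt (hx i)) (by linarith)
  · exact ((Metric.isBounded_closedBall (x := (0 : RN N)) (r := N * r / 2)).subset fun x hx => by
      rw [mem_closedBall_zero_iff]; exact norm_le_of_mem_cube hr hx).isCompact_closure

theorem closure_cube_subset {r s : ℝ} (h : r < s) : closure (cube N r) ⊆ cube N s := by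
  have hc : IsClosed {x : RN N | ∀ i, |x i| ≤ r / 2} := by
    simp only [Set.ofPred_forall]
    exact isClosed_iInter fun i => isClosed_le (by fun_prop) continuous_const
  refine (closure_minimal (fun x hx i => (hx i).le) hc).trans fun x hx i => ?_
  exact lt_of_le_of_lt (hx i) (by linarith)

end Cubes

/-! ### From weak solutions to Hölder decay -/

section Main

open Filter Topology

variable {N : ℕ}

/-- A measurable representative `v` makes superlevel sets measurable. The field is still formed with
`u`, which is harmless as the growth conditions hold for all `s`. Replacing `C₁` by `max C₁ 0` only
weakens the bound. -/
theorem IsWeakSolution.exists_isLocalSolution {p C₀ C₁ R₀ : ℝ} (hp : 1 < p) {Ω : Set (RN N)}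
    (hΩ : IsOpen Ω) (hball : Metric.closedBall 0 R₀ ⊆ Ω) {A : RN N → ℝ → RN N → RN N}
    (hA : PGrowth p C₀ C₁ Ω A) {u : RN N → ℝ} (hu : IsWeakSolution p A Ω u) :
    ∃ (v : RN N → ℝ) (G V : RN N → RN N), v =ᵐ[volume.restrict (Metric.closedBall 0 R₀)] u ∧
      IsLocalSolution p C₀ (max C₁ 0) R₀ v G V := by
  obtain ⟨hup, hub, G, hG, hGp, hV, heq⟩ := hu
  have hS : IsCompact (Metric.closedBall (0 : RN N) R₀) := isCompact_closedBall 0 R₀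
  have hum := (hup _ hS hball).1
  obtain ⟨f, M, hfs, hfM, hft, hfg⟩ := hG.exists_smooth_approx hp hΩ hS hball hub hGp
  have hvu := hum.ae_eq_mk
  refine ⟨hum.mk u, G, fun x => A x (u x) (G x), hvu.symm, ?_⟩
  refine ⟨hum.stronglyMeasurable_mk.measurable, ⟨f, M, ⟨hfs, ?_, hfg⟩, hfM⟩, hGp _ hS hball,
    hV.mono_measure (Measure.restrict_mono hball le_rfl), ?_, ?_, fun φ hφ hsupp => ?_⟩
  · filter_upwards [hft, hvu] with x hx hx'
    rwa [← hx']
  · filter_upwards [ae_restrict_of_ae_restrict_of_subset hball hA.coercive] with x hx using hx _ _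
  · filter_upwards [ae_restrict_of_ae_restrict_of_subset hball hA.bounded] with x hx
    refine (hx _ _).trans ?_
    gcongr
    exact le_max_left _ _
  · rw [← heq φ ⟨hφ, hS.of_isClosed_subset (isClosed_tsupport φ) hsupp, hsupp.trans hball⟩]
    refine (setIntegral_eq_of_subset_of_forall_sdiff_eq_zero hΩ.measurableSet hball
      fun x hx => ?_).symm
    have : fderiv ℝ φ x = 0 := image_eq_zero_of_notMem_tsupport fun h =>
      hx.2 (hsupp (tsupport_fderiv_subset ℝ h))
    rw [this]
    rfl

theorem exists_holder_decay {p C₀ C₁ : ℝ} (hp : 1 < p) (hN : (1 : ℝ) < N) (hC₀ : 0 < C₀)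
    (hC₁ : 0 ≤ C₁) :
    ∃ θ : ℝ, 0 < θ ∧ θ < 1 ∧ ∀ (R₀ : ℝ) (u : RN N → ℝ) (G V : RN N → RN N), 0 < R₀ →
      IsLocalSolution p C₀ C₁ R₀ u G V → ∀ m M : ℝ, m ≤ M →
      (∀ᵐ x ∂volume.restrict (Metric.ball (0 : RN N) R₀), m ≤ u x ∧ u x ≤ M) → ∀ n : ℕ,
      ∃ m' M', m' ≤ M' ∧ M' - m' = θ ^ n * (M - m) ∧
        ∀ᵐ x ∂volume.restrict (Metric.ball (0 : RN N) (R₀ / 4 ^ n)), m' ≤ u x ∧ u x ≤ M' := by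
  have hN0 : NeZero N := ⟨by rintro rfl; norm_num at hN⟩
  obtain ⟨θ, hθ0, hθ1, hred⟩ := exists_osc_reduction hp hC₀ hC₁
    (Real.HolderConjugate.conjExponent hN)
  refine ⟨θ, hθ0, hθ1, fun R₀ u G V hR h m M hmM hu n => ?_⟩
  induction n with
  | zero => exact ⟨m, M, hmM, by simp, by simpa using hu⟩
  | succ n ih =>
    obtain ⟨m₁, M₁, h1, h2, h3⟩ := ih
    obtain ⟨m₂, M₂, h4, h5, h6⟩ := hred R₀ u G V h (R₀ / 4 ^ n) m₁ M₁ (by positivity)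
      (div_le_self hR.le (one_le_pow₀ (by norm_num))) h1 h3
    refine ⟨m₂, M₂, h4, by rw [h5, h2, pow_succ]; ring, ?_⟩
    rwa [pow_succ, ← div_div]

end Main

theorem mainTheorem8 (N : ℕ) (p C₀ C₁ : ℝ) (hp : 1 < p) (hpN : p < N) (hC₀ : 0 < C₀) :
    ∃ C α : ℝ, 0 < C ∧ 0 < α ∧
      ∀ (R : ℝ), 0 < R →
      ∀ (A : RN N → ℝ → RN N → RN N), PGrowth p C₀ C₁ (cube N (2 * R)) A →
      ∀ u : RN N → ℝ, IsWeakSolution p A (cube N (2 * R)) u →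
      ∀ ρ : ℝ, 0 ≤ ρ → ρ ≤ R / 2 →
        osc u (cube N ρ) ≤ C * osc u (cube N R) * (ρ / R) ^ α := by
  have hN : (1 : ℝ) < N := hp.trans hpN
  obtain ⟨θ, hθ0, hθ1, hdecay⟩ := exists_holder_decay hp hN hC₀ (le_max_right C₁ 0)
  set α := -Real.logb 4 θ with hα
  have hα0 : 0 < α := by
    rw [hα, neg_pos]
    exact Real.logb_neg (by norm_num) hθ0 hθ1
  have hθα : θ = 4 ^ (-α) := by
    rw [hα, neg_neg, Real.rpow_logb (by norm_num) (by norm_num) hθ0]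
  -- One factor 2 comes from starting at radius `R / 2`, a factor 4 from rounding to a power of 4,
  -- and `N` from enclosing a cube in a ball.
  refine ⟨(8 * N) ^ α, α, by positivity, hα0, fun R hR A hA u hu ρ hρ hρR => ?_⟩
  rcases hρ.eq_or_lt with rfl | hρ0
  · have : cube N 0 = ∅ := by
      refine Set.eq_empty_of_forall_notMem fun x hx => ?_
      have := hx ⟨0, by exact_mod_cast (zero_lt_one.trans hN)⟩
      rw [zero_div] at this
      exact absurd this (not_lt.2 (abs_nonneg _))
    rw [this, osc_eq_zero_of_volume_eq_zero measure_empty, zero_div, Real.zero_rpow hα0.ne',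
      mul_zero]
  obtain ⟨B, hB⟩ := hu.2.1 _ (isCompact_closure_cube R) (closure_cube_subset (by linarith))
  have hmM := ae_mem_essInf_essSup (ae_restrict_of_ae_restrict_of_subset subset_closure hB)
  have hosc : osc u (cube N R) = essSup u (volume.restrict (cube N R)) -
    essInf u (volume.restrict (cube N R)) := rfl
  set M := essSup u (volume.restrict (cube N R))
  set m := essInf u (volume.restrict (cube N R))
  have hmM' : m ≤ M := by
    have : NeZero (volume.restrict (cube N R)) :=
      ⟨by rw [Ne, Measure.restrict_eq_zero]; exact volume_cube_ne_zero hR⟩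
    obtain ⟨x, hx⟩ := hmM.exists
    exact hx.1.trans hx.2
  rw [hosc]
  have hratio : (8 * N : ℝ) ^ α * (M - m) * (ρ / R) ^ α = (8 * N * ρ / R) ^ α * (M - m) := by
    rw [mul_div_assoc, Real.mul_rpow (x := 8 * (N : ℝ)) (by positivity) (by positivity)]
    ring
  rw [hratio]
  -- If `ρ` is comparable to `R`, the factor `(8 * N * ρ / R) ^ α` is at least 1 and monotonicity of
  -- the oscillation suffices.
  rcases lt_or_ge (R / 2) (N * ρ) with hbig | hsmall
  · have h1 := osc_le_of_ae (volume_cube_ne_zero hρ0)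
      (ae_restrict_of_ae_restrict_of_subset (cube_mono (by linarith : ρ ≤ R)) hmM)
    refine h1.trans (le_mul_of_one_le_left (by linarith) ?_)
    refine Real.one_le_rpow ?_ hα0.le
    rw [le_div_iff₀ hR]
    linarith
  · have hball : Metric.closedBall (0 : RN N) (R / 2) ⊆ cube N (2 * R) :=
      (Metric.closedBall_subset_ball (by linarith)).trans (ball_subset_cube (2 * R))
    obtain ⟨v, G, V, hvu, hsol⟩ := hu.exists_isLocalSolution hp (isOpen_cube _) hball hA
    have hv : ∀ᵐ x ∂volume.restrict (Metric.ball (0 : RN N) (R / 2)), m ≤ v x ∧ v x ≤ M := by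
      filter_upwards [ae_restrict_of_ae_restrict_of_subset (ball_subset_cube R) hmM,
        ae_restrict_of_ae_restrict_of_subset Metric.ball_subset_closedBall hvu] with x hx hx'
      rwa [hx']
    have hNρ : 0 < N * ρ := by positivity
    -- The last scale whose ball still has radius at least `N * ρ`, hence contains the cube of side
    -- `ρ`; maximality gives `4 ^ (-n) < 8 * N * ρ / R`.
    obtain ⟨n, hn1, hn2⟩ := exists_nat_pow_near (x := R / 2 / (N * ρ)) (y := 4)
      (by rwa [le_div_iff₀ hNρ, one_mul]) (by norm_num)
    obtain ⟨m', M', -, hw, hae⟩ := hdecay (R / 2) v G V (by positivity) hsol m M hmM' hv n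
    have hsub : cube N ρ ⊆ Metric.ball 0 (R / 2 / 4 ^ n) := by
      intro x hx
      rw [mem_ball_zero_iff]
      refine (norm_le_of_mem_cube hρ hx).trans_lt ?_
      rw [le_div_iff₀ hNρ] at hn1
      have : N * ρ ≤ R / 2 / 4 ^ n := by rw [le_div_iff₀ (by positivity)]; linarith
      linarith
    have hsub' : cube N ρ ⊆ Metric.closedBall 0 (R / 2) :=
      (hsub.trans (Metric.ball_subset_ball (div_le_self (by positivity)
        (one_le_pow₀ (by norm_num))))).trans Metric.ball_subset_closedBall
    have h1 : osc u (cube N ρ) ≤ M' - m' := by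
      refine osc_le_of_ae (volume_cube_ne_zero hρ0) ?_
      filter_upwards [ae_restrict_of_ae_restrict_of_subset hsub hae,
        ae_restrict_of_ae_restrict_of_subset hsub' hvu] with x hx hx'
      rwa [← hx']
    rw [hw] at h1
    refine h1.trans (mul_le_mul_of_nonneg_right ?_ (by linarith))
    have h2 : θ ^ n = ((1 / 4) ^ n) ^ α := by
      rw [hθα, Real.rpow_neg (by norm_num), ← Real.inv_rpow (by norm_num), ← Real.rpow_natCast,
        ← Real.rpow_natCast, ← Real.rpow_mul (by norm_num), ← Real.rpow_mul (by norm_num),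
        mul_comm α, one_div]
    rw [h2]
    refine Real.rpow_le_rpow (by positivity) ?_ hα0.le
    rw [div_lt_iff₀ hNρ, pow_succ] at hn2
    rw [le_div_iff₀ hR, one_div, inv_pow, inv_mul_le_iff₀ (by positivity)]
    linarith
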